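/- For complex numbers $a,q$ and integers $n\ge 0$ put $(a;q)_n=\prod_{k=0}^{n-1}(1-aq^k)$ and, for $|q|<1$, $(a;q)_\infty=\prod_{k=0}^{\infty}(1-aq^k)$ and $(a,b,c;q)_\infty=(a;q)_\infty(b;q)_\infty(c;q)_\infty$. For integers $n,k$ let $\left[\begin{matrix}n\\k\end{matrix}\right]_{q}=\frac{(q;q)_n}{(q;q)_k(q;q)_{n-k}}$ if $0\le k\le n$, and $0$ otherwise. Let $m\ge 0$ be an integer and let $q$ be a complex number with $|q|<1$, and $q\neq 0$ if $m\geq 2$. Then the series on the left converges and $$\sum_{n=0}^{\infty}\frac{(-q;q^2)_n\,q^{n^2+2mn}}{(q;q^2)_{m+n}(q^2;q^2)_n}=\frac{(-1)^{m-1}}{q^{m(m-1)}(-q^2;q^2)_{m-1}(q;q)_\infty}\Big[a_m(q)\,(q^2,q^{10},q^{12};q^{12})_\infty-b_m(q)\,(q^6,q^6,q^{12};q^{12})_\infty\Big],$$ where for $m=0$ the factors $q^{m(m-1)}$ and $(-q^2;q^2)_{m-1}$ are both read as $1$ (the latter as an empty product), $a_0(q)=0$, $b_0(q)=1$, and for $m\ge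 1$ $$a_m(q)=\sum_{n,j,l\ge 0}(-1)^j q^{n^2+l^2}\left[\begin{matrix}m-1-n+j\\j\end{matrix}\right]_{q^2}\left[\begin{matrix}m-1-j-l\\n-j-l\end{matrix}\right]_{q^2}\left[\begin{matrix}m-1-n\\l\end{matrix}\right]_{q^2},$$ $$b_m(q)=\sum_{n,j,l\ge 0}(-1)^j q^{n^2+2n+l^2}\left[\begin{matrix}m-2-n+j\\j\end{matrix}\right]_{q^2}\left[\begin{matrix}m-2-j-l\\n-j-l\end{matrix}\right]_{q^2}\left[\begin{matrix}m-2-n\\l\end{matrix}\right]_{q^2}$$ (both sums have only finitely many nonzero terms). -/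

import Mathlib

namespace SlaterMVersion

noncomputable section

/-- The finite `q`-shifted factorial `(a; q)_n = (1 - a)(1 - a q) ⋯ (1 - a q ^ (n - 1))`,
for a natural number `n`. -/
def qPoch (a q : ℂ) (n : ℕ) : ℂ := ∏ k ∈ Finset.range n, (1 - a * q ^ k)

/-- The infinite `q`-shifted factorial `(a; q)_∞ = ∏_{k ≥ 0} (1 - a q ^ k)`, for `|q| < 1`. -/
def qPochInf (a q : ℂ) : ℂ := ∏' k : ℕ, (1 - a * q ^ k)

/-- The product defining `(a; q)_∞` converges when `|q| < 1`. -/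
theorem multipliable_qPochInf (a q : ℂ) (hq : ‖q‖ < 1) :
    Multipliable fun k : ℕ => 1 - a * q ^ k := by
  have h : Summable fun k : ℕ => ‖-(a * q ^ k)‖ := by
    simpa [norm_mul, norm_pow] using (summable_geometric_of_lt_one (norm_nonneg q) hq).mul_left ‖a‖
  simpa [sub_eq_add_neg] using multipliable_one_add_of_summable h

/-- The product `(a, b, c; q)_∞ = (a; q)_∞ (b; q)_∞ (c; q)_∞`. -/
def qPochInf₃ (a b c q : ℂ) : ℂ := qPochInf a q * qPochInf b q * qPochInf c q

/-- The Gaussian binomial coefficient with top `n` and bottom `m` (arbitrary integers) in base `q`: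
it is `(q; q)_n / ((q; q)_m (q; q)_{n - m})` if `0 ≤ m ≤ n`, and `0` otherwise. -/
def gaussBinom (q : ℂ) (n m : ℤ) : ℂ :=
  if 0 ≤ m ∧ m ≤ n then
    qPoch q q n.toNat / (qPoch q q m.toNat * qPoch q q (n - m).toNat)
  else 0

/-- The summand, indexed by `p = (n, j, l)`, of the triple sum `a_m(q)`, `m ≥ 1`. -/
def aTerm (q : ℂ) (m : ℕ) (p : ℕ × ℕ × ℕ) : ℂ :=
  let n := p.1
  let j := p.2.1
  let l := p.2.2
  (-1) ^ j * q ^ (n ^ 2 + l ^ 2)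
    * gaussBinom (q ^ 2) ((m : ℤ) - 1 - n + j) j
    * gaussBinom (q ^ 2) ((m : ℤ) - 1 - j - l) ((n : ℤ) - j - l)
    * gaussBinom (q ^ 2) ((m : ℤ) - 1 - n) l

/-- The summand, indexed by `p = (n, j, l)`, of the triple sum `b_m(q)`, `m ≥ 1`. -/
def bTerm (q : ℂ) (m : ℕ) (p : ℕ × ℕ × ℕ) : ℂ :=
  let n := p.1
  let j := p.2.1
  let l := p.2.2
  (-1) ^ j * q ^ (n ^ 2 + 2 * n + l ^ 2)
    * gaussBinom (q ^ 2) ((m : ℤ) - 2 - n + j) j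
    * gaussBinom (q ^ 2) ((m : ℤ) - 2 - j - l) ((n : ℤ) - j - l)
    * gaussBinom (q ^ 2) ((m : ℤ) - 2 - n) l

/-- `a_0(q) = 0`, and for `m ≥ 1`, `a_m(q)` is the sum of its summands over all `n, j, l ≥ 0`
(only finitely many of which are nonzero). -/
def aCoeff (q : ℂ) (m : ℕ) : ℂ :=
  if m = 0 then 0 else ∑' p : ℕ × ℕ × ℕ, aTerm q m p

/-- `b_0(q) = 1`, and for `m ≥ 1`, `b_m(q)` is the sum of its summands over all `n, j, l ≥ 0`
(only finitely many of which are nonzero). -/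
def bCoeff (q : ℂ) (m : ℕ) : ℂ :=
  if m = 0 then 1 else ∑' p : ℕ × ℕ × ℕ, bTerm q m p

/-- The triple sum `a_m(q)` is a finite sum. -/
theorem aTerm_eq_zero (q : ℂ) (m : ℕ) (p : ℕ × ℕ × ℕ)
    (hp : p ∉ Finset.range m ×ˢ Finset.range m ×ˢ Finset.range m) : aTerm q m p = 0 := by
  obtain ⟨n, j, l⟩ := p
  simp only [Finset.mem_product, Finset.mem_range] at hp
  by_cases h₁ : 0 ≤ (n : ℤ) - j - l ∧ (n : ℤ) - j - l ≤ (m : ℤ) - 1 - j - l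
  · have h₂ : ¬ (0 ≤ (l : ℤ) ∧ (l : ℤ) ≤ (m : ℤ) - 1 - n) := by omega
    simp only [aTerm, gaussBinom, if_neg h₂, mul_zero]
  · simp only [aTerm, gaussBinom, if_neg h₁, mul_zero, zero_mul]

/-- The triple sum `b_m(q)` is a finite sum. -/
theorem bTerm_eq_zero (q : ℂ) (m : ℕ) (p : ℕ × ℕ × ℕ)
    (hp : p ∉ Finset.range m ×ˢ Finset.range m ×ˢ Finset.range m) : bTerm q m p = 0 := by
  obtain ⟨n, j, l⟩ := p
  simp only [Finset.mem_product, Finset.mem_range] at hp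
  by_cases h₁ : 0 ≤ (n : ℤ) - j - l ∧ (n : ℤ) - j - l ≤ (m : ℤ) - 2 - j - l
  · have h₂ : ¬ (0 ≤ (l : ℤ) ∧ (l : ℤ) ≤ (m : ℤ) - 2 - n) := by omega
    simp only [bTerm, gaussBinom, if_neg h₂, mul_zero]
  · simp only [bTerm, gaussBinom, if_neg h₁, mul_zero, zero_mul]

end

end SlaterMVersion

namespace SlaterMVersion

open Filter Topology

noncomputable section

/-! Write S_m for the series. A termwise identity gives the contiguous relation S_m - S_{m+1} =
q^{2(m+1)} (1 + q^{2(m+1)}) S_{m+2} (`tsum_slaterTerm_sub`), so S_0 and S_1 determine every S_m as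
soon as q ≠ 0. Multiplying S_m by (-1)^{m-1} q^{m(m-1)} (-q²;q²)_{m-1} turns it, for m ≥ 1, into
c_{m+2} = c_{m+1} + q^{2m} (1 + q^{2m}) c_m. It remains to evaluate S_0 and S_1 and to show that a_m
and b_m solve this recurrence.

The initial values follow Bailey's method. The denominators of S_0 and S_1 are expanded as bilateral
sums over r with weight q^{2r²+r} (`baileyPair_even`, `baileyPair_odd`). After exchanging the sums,
the inner sum over n has a closed form (`tsum_conjugate_even`, `tsum_conjugate_odd`). What remains
is a theta series, which the Jacobi triple product converts to the stated products (`slater_zero`,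
`slater_one`).

For the coefficients, the sums over j and l form a Cauchy product: both triple sums equal ∑_{k+n=M}
q^{n²+en} [tⁿ] (-qt;q²)_k / (t²;q⁴)_{k+1}, with (e, M) = (0, m-1) for a_m and (2, m-2) for b_m. The
functional equation of this kernel in k gives the recurrence (`kernelSum_add_two`). -/

theorem qPoch_zero (a q : ℂ) : qPoch a q 0 = 1 := by simp [qPoch]

theorem qPoch_succ (a q : ℂ) (n : ℕ) : qPoch a q (n + 1) = qPoch a q n * (1 - a * q ^ n) := by
  simp [qPoch, Finset.prod_range_succ]

/-! ### Infinite products: limits, bounds, non-vanishing, dissections -/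

theorem tendsto_qPoch (a : ℂ) {q : ℂ} (hq : ‖q‖ < 1) :
    Tendsto (qPoch a q) atTop (𝓝 (qPochInf a q)) :=
  (multipliable_qPochInf a q hq).hasProd.tendsto_prod_nat

theorem qPoch_ne_zero {a q : ℂ} (h : ∀ k : ℕ, 1 - a * q ^ k ≠ 0) (n : ℕ) : qPoch a q n ≠ 0 :=
  Finset.prod_ne_zero_iff.2 fun k _ => h k

theorem qPochInf_ne_zero {a q : ℂ} (hq : ‖q‖ < 1) (h : ∀ k : ℕ, 1 - a * q ^ k ≠ 0) :
    qPochInf a q ≠ 0 := by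
  have hs : Summable fun k : ℕ => ‖-(a * q ^ k)‖ := by
    simpa [norm_mul, norm_pow] using (summable_geometric_of_lt_one (norm_nonneg q) hq).mul_left ‖a‖
  have := tprod_one_add_ne_zero_of_summable (f := fun k : ℕ => -(a * q ^ k))
    (fun k => by simpa [sub_eq_add_neg] using h k) hs
  simpa [qPochInf, sub_eq_add_neg] using this

theorem one_sub_mul_pow_ne_zero {a q : ℂ} (ha : ‖a‖ < 1) (hq : ‖q‖ < 1) (k : ℕ) :
    1 - a * q ^ k ≠ 0 := by
  intro h
  have h1 : ‖a * q ^ k‖ < 1 := by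
    rw [norm_mul, norm_pow]
    exact mul_lt_one_of_nonneg_of_lt_one_left (norm_nonneg _) ha
      (pow_le_one₀ (norm_nonneg _) hq.le)
  rw [← sub_eq_zero.1 h] at h1
  simp at h1

theorem norm_pow_lt_one {q : ℂ} (hq : ‖q‖ < 1) {n : ℕ} (hn : n ≠ 0) : ‖q ^ n‖ < 1 := by
  rw [norm_pow]
  exact pow_lt_one₀ (norm_nonneg _) hq hn

theorem exists_norm_qPoch_le (a : ℂ) {q : ℂ} (hq : ‖q‖ < 1) :
    ∃ C : ℝ, 0 < C ∧ ∀ n, ‖qPoch a q n‖ ≤ C := by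
  obtain ⟨C, hC⟩ := (tendsto_qPoch a hq).norm.bddAbove_range
  exact ⟨max C 1, by positivity, fun n => (hC ⟨n, rfl⟩).trans (le_max_left _ _)⟩

theorem exists_norm_qPoch_inv_le {a q : ℂ} (ha : ‖a‖ < 1) (hq : ‖q‖ < 1) :
    ∃ C : ℝ, 0 < C ∧ ∀ n, ‖(qPoch a q n)⁻¹‖ ≤ C := by
  obtain ⟨C, hC⟩ := ((tendsto_qPoch a hq).inv₀
    (qPochInf_ne_zero hq (one_sub_mul_pow_ne_zero ha hq))).norm.bddAbove_range
  exact ⟨max C 1, by positivity, fun n => (hC ⟨n, rfl⟩).trans (le_max_left _ _)⟩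

theorem qPochInf_sq (a : ℂ) {q : ℂ} (hq : ‖q‖ < 1) :
    qPochInf a (q ^ 2) * qPochInf (a * q) (q ^ 2) = qPochInf a q := by
  have h2 := norm_pow_lt_one hq two_ne_zero
  have h : ∀ n, qPoch a q (2 * n) = qPoch a (q ^ 2) n * qPoch (a * q) (q ^ 2) n := by
    intro n
    induction n with
    | zero => simp [qPoch]
    | succ n ih =>
      rw [show 2 * (n + 1) = 2 * n + 1 + 1 by ring]
      simp only [qPoch_succ, ih]
      ring
  refine tendsto_nhds_unique ((tendsto_qPoch a h2).mul (tendsto_qPoch (a * q) h2)) ?_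
  simp_rw [← h]
  exact (tendsto_qPoch a hq).comp (tendsto_id.const_mul_atTop' two_pos)

theorem qPochInf_cube (a : ℂ) {q : ℂ} (hq : ‖q‖ < 1) :
    qPochInf a (q ^ 3) * qPochInf (a * q) (q ^ 3) * qPochInf (a * q ^ 2) (q ^ 3) =
      qPochInf a q := by
  have h3 := norm_pow_lt_one hq three_ne_zero
  have h : ∀ n, qPoch a q (3 * n) =
      qPoch a (q ^ 3) n * qPoch (a * q) (q ^ 3) n * qPoch (a * q ^ 2) (q ^ 3) n := by
    intro n
    induction n with
    | zero => simp [qPoch]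
    | succ n ih =>
      rw [show 3 * (n + 1) = 3 * n + 1 + 1 + 1 by ring]
      simp only [qPoch_succ, ih]
      ring
  refine tendsto_nhds_unique (((tendsto_qPoch a h3).mul (tendsto_qPoch (a * q) h3)).mul
    (tendsto_qPoch (a * q ^ 2) h3)) ?_
  simp_rw [← h]
  exact (tendsto_qPoch a hq).comp (tendsto_id.const_mul_atTop' three_pos)

theorem qPochInf_mul_neg (a : ℂ) {q : ℂ} (hq : ‖q‖ < 1) :
    qPochInf a q * qPochInf (-a) q = qPochInf (a ^ 2) (q ^ 2) := by
  refine tendsto_nhds_unique ((tendsto_qPoch a hq).mul (tendsto_qPoch (-a) hq)) ?_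
  refine (tendsto_qPoch (a ^ 2) (norm_pow_lt_one hq two_ne_zero)).congr fun n => ?_
  rw [qPoch, qPoch, qPoch, ← Finset.prod_mul_distrib]
  exact Finset.prod_congr rfl fun k _ => by ring

theorem qPochInf_eq_one_sub_mul (a : ℂ) {q : ℂ} (hq : ‖q‖ < 1) :
    qPochInf a q = (1 - a) * qPochInf (a * q) q := by
  refine tendsto_nhds_unique ((tendsto_qPoch a hq).comp (tendsto_add_atTop_nat 1)) ?_
  refine ((tendsto_qPoch (a * q) hq).const_mul (1 - a)).congr fun n => ?_
  simp only [Function.comp, qPoch]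
  rw [Finset.prod_range_succ']
  simp [mul_comm, mul_assoc, pow_succ']

theorem qPochInf_self_ne_zero {q : ℂ} (hq : ‖q‖ < 1) : qPochInf q q ≠ 0 :=
  qPochInf_ne_zero hq (one_sub_mul_pow_ne_zero hq hq)

/-- Euler's identity `(q; q²)_∞ (-q; q)_∞ = 1`. -/
theorem qPochInf_odd_mul_neg {q : ℂ} (hq : ‖q‖ < 1) :
    qPochInf q (q ^ 2) * qPochInf (-q) q = 1 := by
  have h1 := qPochInf_sq q hq
  have h2 := qPochInf_mul_neg q hq
  rw [← sq] at h1
  have h3 := qPochInf_self_ne_zero (norm_pow_lt_one hq two_ne_zero)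
  apply mul_right_cancel₀ h3
  rw [← h1] at h2
  linear_combination h2

/-! ### Reciprocal q-factorials with integer index, and summability -/

/-- The reciprocal `1 / (q; q)_k`, read as `0` for negative `k`. -/
def qPochInv (q : ℂ) (k : ℤ) : ℂ := if 0 ≤ k then (qPoch q q k.toNat)⁻¹ else 0

theorem qPochInv_of_neg (q : ℂ) {k : ℤ} (hk : k < 0) : qPochInv q k = 0 := by
  simp [qPochInv, not_le.2 hk]

theorem qPochInv_natCast (q : ℂ) (k : ℕ) : qPochInv q k = (qPoch q q k)⁻¹ := by
  simp [qPochInv]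

/-- Setting the reciprocal to 0 at negative indices makes the recurrence valid for every integer: at
k = 0 the factor 1 - q^0 supplies the zero. Bilateral sums can then be manipulated without boundary
cases. -/
theorem one_sub_zpow_mul_qPochInv {q : ℂ} (hq : ‖q‖ < 1) (k : ℤ) :
    (1 - q ^ k) * qPochInv q k = qPochInv q (k - 1) := by
  rcases lt_trichotomy k 0 with hk | rfl | hk
  · rw [qPochInv_of_neg q hk, qPochInv_of_neg q (by omega), mul_zero]
  · rw [qPochInv_of_neg q (show (0 : ℤ) - 1 < 0 by omega)]
    simp
  · obtain ⟨n, rfl⟩ : ∃ n : ℕ, k = (n : ℤ) + 1 := ⟨(k - 1).toNat, by omega⟩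
    have h := one_sub_mul_pow_ne_zero hq hq
    have e : (1 : ℂ) - q ^ ((n : ℤ) + 1) = 1 - q * q ^ n := by
      rw [← pow_succ']
      norm_cast
    rw [e, add_sub_cancel_right, qPochInv_natCast,
      show ((n : ℤ) + 1) = ((n + 1 : ℕ) : ℤ) by push_cast; ring, qPochInv_natCast, qPoch_succ]
    have h1 := h n
    have h2 := qPoch_ne_zero h n
    field_simp

theorem exists_norm_qPochInv_le {q : ℂ} (hq : ‖q‖ < 1) :
    ∃ C : ℝ, 0 < C ∧ ∀ k, ‖qPochInv q k‖ ≤ C := by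
  obtain ⟨C, hC, h⟩ := exists_norm_qPoch_inv_le hq hq
  refine ⟨C, hC, fun k => ?_⟩
  rw [qPochInv]
  split_ifs
  · exact h _
  · simpa using hC.le

theorem tendsto_qPochInv {q : ℂ} (hq : ‖q‖ < 1) :
    Tendsto (qPochInv q) atTop (𝓝 (qPochInf q q)⁻¹) := by
  have h0 : Tendsto Int.toNat atTop atTop := by
    refine tendsto_atTop.2 fun b => ?_
    filter_upwards [eventually_ge_atTop (b : ℤ)] with k hk
    omega
  have h := ((tendsto_qPoch q hq).inv₀ (qPochInf_self_ne_zero hq)).comp h0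
  refine h.congr' ?_
  filter_upwards [eventually_ge_atTop 0] with k hk
  simp [qPochInv, hk]

theorem summable_pow_of_lt {x : ℝ} (h0 : 0 ≤ x) (h1 : x < 1) {f : ℕ → ℕ} (hf : ∀ n, n ≤ f n) :
    Summable fun n => x ^ f n :=
  (summable_geometric_of_lt_one h0 h1).of_nonneg_of_le (fun _ => by positivity)
    fun n => pow_le_pow_of_le_one h0 h1.le (hf n)

theorem summable_norm_zpow {q : ℂ} (hq : ‖q‖ < 1) {f : ℤ → ℤ} (hf : ∀ r, |r| ≤ f r) :
    Summable fun r => ‖q ^ f r‖ := by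
  have key : ∀ r, ‖q ^ f r‖ ≤ ‖q‖ ^ r.natAbs := by
    intro r
    obtain ⟨m, hm⟩ := Int.eq_ofNat_of_zero_le ((abs_nonneg r).trans (hf r))
    rw [hm, norm_zpow, zpow_natCast]
    refine pow_le_pow_of_le_one (norm_nonneg _) hq.le ?_
    have := hf r
    rw [hm, Int.abs_eq_natAbs] at this
    exact_mod_cast this
  refine Summable.of_nonneg_of_le (fun _ => norm_nonneg _) key ?_
  have h := summable_geometric_of_lt_one (norm_nonneg q) hq
  exact Summable.of_nat_of_neg (by simpa using h) (by simpa using h)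

theorem summable_weight {q : ℂ} (hq : ‖q‖ < 1) {w : ℤ → ℂ} (hs : Summable fun r => ‖w r‖)
    (f g : ℤ → ℤ) : Summable fun r => w r * qPochInv q (f r) * qPochInv q (g r) := by
  obtain ⟨C, hC, h⟩ := exists_norm_qPochInv_le hq
  refine Summable.of_norm_bounded ((hs.mul_right C).mul_right C) fun r => ?_
  rw [norm_mul, norm_mul]
  gcongr
  · exact h _
  · exact h _

/-! ### The Jacobi triple product -/

section TripleProduct

variable {q z : ℂ} {w : ℤ → ℂ}

/-- Split 1 - q^{2n} = (1 - q^{n-r}) + q^{n-r} (1 - q^{n+r}); each bracket lowers one index. The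
recurrence of `w` turns q^{n-r} w_r into -z q^{n-1} w_{r-1}, so the second piece is a shift in r of
the first. -/
theorem tripleProduct_even_step (hq : ‖q‖ < 1) (hq0 : q ≠ 0)
    (hw : ∀ r, w (r + 1) = -z * q ^ r * w r) (hs : Summable fun r => ‖w r‖) (n : ℤ) :
    (1 - q ^ (2 * n)) * ∑' r, w r * qPochInv q (n - r) * qPochInv q (n + r) =
      (1 - z * q ^ (n - 1)) *
        ∑' r, w r * qPochInv q (n - 1 - r) * qPochInv q (n - 1 + 1 + r) := by
  have hS := summable_weight hq hs (fun r => n - 1 - r) (fun r => n - 1 + 1 + r)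
  have e : ∀ r, (1 - q ^ (2 * n)) * (w r * qPochInv q (n - r) * qPochInv q (n + r)) =
      w r * qPochInv q (n - 1 - r) * qPochInv q (n - 1 + 1 + r) + -z * q ^ (n - 1) *
        (w (r + -1) * qPochInv q (n - 1 - (r + -1)) * qPochInv q (n - 1 + 1 + (r + -1))) := by
    intro r
    have h1 := one_sub_zpow_mul_qPochInv hq (n - r)
    have h2 := one_sub_zpow_mul_qPochInv hq (n + r)
    have h3 := hw (r + -1)
    have h4 : q ^ (2 * n) = q ^ (n - r) * q ^ (n + r) := by rw [← zpow_add₀ hq0]; congr 1; ring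
    have h5 : q ^ (n - r) * q ^ (r + -1) = q ^ (n - 1) := by
      rw [← zpow_add₀ hq0]; congr 1; ring
    rw [show n - 1 - r = n - r - 1 by ring, show n - 1 + 1 + r = n + r by ring,
      show n - 1 - (r + -1) = n - r by ring, show n - 1 + 1 + (r + -1) = n + r - 1 by ring,
      ← h1, ← h2, h4, ← h5]
    rw [show r + -1 + 1 = r by ring] at h3
    rw [h3]
    ring
  have hshift := (Equiv.addRight (-1 : ℤ)).tsum_eq
    (fun r => w r * qPochInv q (n - 1 - r) * qPochInv q (n - 1 + 1 + r))
  simp only [Equiv.coe_addRight] at hshift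
  rw [← tsum_mul_left, tsum_congr e, Summable.tsum_add hS, tsum_mul_left, hshift]
  · ring
  · exact ((Equiv.addRight (-1 : ℤ)).summable_iff.2 hS).mul_left _

/-- The same argument with 1 - q^{2n+1} = (1 - q^{n+1+r}) + q^{n+1+r} (1 - q^{n-r}), shifting r in
the opposite direction. -/
theorem tripleProduct_odd_step (hq : ‖q‖ < 1) (hq0 : q ≠ 0) (hz : z ≠ 0)
    (hw : ∀ r, w (r + 1) = -z * q ^ r * w r) (hs : Summable fun r => ‖w r‖) (n : ℤ) :
    (1 - q ^ (2 * n + 1)) * ∑' r, w r * qPochInv q (n - r) * qPochInv q (n + 1 + r) =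
      (1 - q ^ (n + 1) / z) * ∑' r, w r * qPochInv q (n - r) * qPochInv q (n + r) := by
  have hS := summable_weight hq hs (fun r => n - r) (fun r => n + r)
  have e : ∀ r, (1 - q ^ (2 * n + 1)) * (w r * qPochInv q (n - r) * qPochInv q (n + 1 + r)) =
      w r * qPochInv q (n - r) * qPochInv q (n + r) + -(q ^ (n + 1) / z) *
        (w (r + 1) * qPochInv q (n - (r + 1)) * qPochInv q (n + (r + 1))) := by
    intro r
    have h1 := one_sub_zpow_mul_qPochInv hq (n - r)
    have h2 := one_sub_zpow_mul_qPochInv hq (n + 1 + r)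
    have h4 : q ^ (2 * n + 1) = q ^ (n - r) * q ^ (n + 1 + r) := by
      rw [← zpow_add₀ hq0]; congr 1; ring
    have h5 : q ^ (n + 1) * q ^ r = q ^ (n + 1 + r) := by
      rw [← zpow_add₀ hq0]
    rw [show n + r = n + 1 + r - 1 by ring,
      show n - (r + 1) = n - r - 1 by ring, show n + (r + 1) = n + 1 + r by ring,
      ← h1, ← h2, h4, hw]
    field_simp
    linear_combination (-w r * qPochInv q (n - r) * (qPochInv q (n + 1 + r)) *
      (1 - q ^ (n - r))) * h5
  have hshift := (Equiv.addRight (1 : ℤ)).tsum_eq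
    (fun r => w r * qPochInv q (n - r) * qPochInv q (n + r))
  simp only [Equiv.coe_addRight] at hshift
  rw [← tsum_mul_left, tsum_congr e, Summable.tsum_add hS, tsum_mul_left, hshift]
  · ring
  · exact ((Equiv.addRight (1 : ℤ)).summable_iff.2 hS).mul_left _

theorem tsum_qPochInv_zero (hw0 : w 0 = 1) :
    ∑' r, w r * qPochInv q (0 - r) * qPochInv q (0 + r) = 1 := by
  rw [tsum_eq_single 0]
  · simp [hw0, qPochInv, qPoch]
  · intro r hr
    rcases lt_or_gt_of_ne hr with h | h
    · rw [qPochInv_of_neg q (show 0 + r < 0 by omega), mul_zero]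
    · rw [qPochInv_of_neg q (show 0 - r < 0 by omega), mul_zero, zero_mul]

theorem one_sub_zpow_ne_zero (hq : ‖q‖ < 1) {n : ℤ} (hn : 0 < n) : 1 - q ^ n ≠ 0 := by
  obtain ⟨k, rfl⟩ : ∃ k : ℕ, n = (k : ℤ) + 1 := ⟨(n - 1).toNat, by omega⟩
  have h := one_sub_mul_pow_ne_zero hq hq k
  rw [← pow_succ'] at h
  exact_mod_cast h

/-- A finite form of the Jacobi triple product identity. -/
theorem finite_tripleProduct (hq : ‖q‖ < 1) (hq0 : q ≠ 0) (hz : z ≠ 0) (hw0 : w 0 = 1)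
    (hw : ∀ r, w (r + 1) = -z * q ^ r * w r) (hs : Summable fun r => ‖w r‖) (n : ℕ) :
    ∑' r, w r * qPochInv q (n - r) * qPochInv q (n + r) =
      qPoch z q n * qPoch (q / z) q n * qPochInv q (2 * n) := by
  induction n with
  | zero =>
    simp only [Nat.cast_zero]
    rw [tsum_qPochInv_zero hw0]
    simp [qPochInv, qPoch]
  | succ n ih =>
    -- The index pair climbs from (n, n) through (n, n+1) to (n+1, n+1), gaining the factor 1 -
    -- q^{n+1}/z and then 1 - z q^n.
    have h1 := tripleProduct_even_step hq hq0 hw hs (n + 1 : ℤ)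
    have h2 := tripleProduct_odd_step hq hq0 hz hw hs (n : ℤ)
    rw [add_sub_cancel_right] at h1
    have h3 := one_sub_zpow_mul_qPochInv hq (2 * (n + 1 : ℤ))
    have h4 := one_sub_zpow_mul_qPochInv hq (2 * (n : ℤ) + 1)
    rw [show 2 * ((n : ℤ) + 1) - 1 = 2 * n + 1 by ring] at h3
    rw [add_sub_cancel_right] at h4
    have h5 : q ^ (2 * (n : ℤ) + 1) ≠ 1 := fun h =>
      one_sub_zpow_ne_zero hq (show 0 < 2 * (n : ℤ) + 1 by omega) (by rw [h, sub_self])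
    have h6 := one_sub_zpow_ne_zero hq (show 0 < 2 * ((n : ℤ) + 1) by omega)
    have h7 := one_sub_zpow_ne_zero hq (show 0 < 2 * (n : ℤ) + 1 by omega)
    push_cast
    apply mul_left_cancel₀ h6
    apply mul_left_cancel₀ h7
    rw [h1, qPoch_succ, qPoch_succ]
    rw [ih, ← h4, ← h3] at h2
    have h8 : q ^ ((n : ℤ) + 1) / z = q / z * q ^ n := by
      rw [zpow_add_one₀ hq0, zpow_natCast]; ring
    rw [h8] at h2
    rw [zpow_natCast]
    linear_combination (1 - z * q ^ n) * h2

/-- The Jacobi triple product identity; the terms `w r` are given by their recurrence. -/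
theorem tsum_eq_tripleProduct (hq : ‖q‖ < 1) (hq0 : q ≠ 0) (hz : z ≠ 0) (hw0 : w 0 = 1)
    (hw : ∀ r, w (r + 1) = -z * q ^ r * w r) (hs : Summable fun r => ‖w r‖) :
    ∑' r, w r = qPochInf z q * qPochInf (q / z) q * qPochInf q q := by
  obtain ⟨C, hC, hb⟩ := exists_norm_qPochInv_le hq
  have hi := tendsto_qPochInv hq
  have hcast : Tendsto (fun n : ℕ => (n : ℤ)) atTop atTop := tendsto_natCast_atTop_atTop
  -- Dominated convergence: each reciprocal factor is bounded and tends to 1/(q;q)_∞.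
  have h1 : Tendsto (fun n : ℕ => ∑' r, w r * qPochInv q (n - r) * qPochInv q (n + r)) atTop
      (𝓝 (∑' r, w r * (qPochInf q q)⁻¹ * (qPochInf q q)⁻¹)) := by
    refine tendsto_tsum_of_dominated_convergence ((hs.mul_right C).mul_right C) (fun r => ?_)
      (Eventually.of_forall fun n r => ?_)
    · refine (tendsto_const_nhds.mul (hi.comp ?_)).mul (hi.comp ?_)
      · exact tendsto_atTop_add_const_right _ (-r) hcast
      · exact tendsto_atTop_add_const_right _ r hcast
    · rw [norm_mul, norm_mul]
      gcongr
      · exact hb _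
      · exact hb _
  have h2 : Tendsto (fun n : ℕ => qPoch z q n * qPoch (q / z) q n * qPochInv q (2 * n)) atTop
      (𝓝 (qPochInf z q * qPochInf (q / z) q * (qPochInf q q)⁻¹)) :=
    ((tendsto_qPoch z hq).mul (tendsto_qPoch _ hq)).mul
      (hi.comp (hcast.const_mul_atTop' two_pos))
  have h3 := tendsto_nhds_unique (h1.congr fun n =>
    finite_tripleProduct hq hq0 hz hw0 hw hs n) h2
  rw [tsum_mul_right, tsum_mul_right] at h3
  have h4 := qPochInf_self_ne_zero hq
  field_simp at h3
  rw [h3]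
  ring

end TripleProduct

/-! ### The Bailey pairs behind S_0 and S_1 -/

section BaileyPair

variable {q : ℂ}

theorem sq_zpow (q : ℂ) (k : ℤ) : (q ^ 2) ^ k = q ^ (2 * k) := by
  rw [zpow_mul]
  norm_cast

theorem one_sub_zpow_two_mul_qPochInv (hq : ‖q‖ < 1) (k : ℤ) :
    (1 - q ^ (2 * k)) * qPochInv (q ^ 2) k = qPochInv (q ^ 2) (k - 1) := by
  rw [← sq_zpow]
  exact one_sub_zpow_mul_qPochInv (norm_pow_lt_one hq two_ne_zero) k

theorem abs_le_two_mul_sq_add (r : ℤ) : |r| ≤ 2 * r ^ 2 + r := by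
  rw [abs_le]
  constructor
  · nlinarith [sq_nonneg r, sq_nonneg (r + 1)]
  · nlinarith [sq_nonneg r]

/-- Lowering n - r costs the factor 1 - q^{2(n-r)}. Its term q^{-2r} changes the weight q^{2r²+r}
into q^{2r²-r}, which is the reflection r ↦ -r; this reflection also swaps the two reciprocal
factors. -/
theorem baileyPair_even_step (hq : ‖q‖ < 1) (hq0 : q ≠ 0) (n : ℤ) :
    (1 - q ^ (2 * n)) *
        ∑' r : ℤ, q ^ (2 * r ^ 2 + r) * qPochInv (q ^ 2) (n - r) * qPochInv (q ^ 2) (n + r) =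
      ∑' r : ℤ, q ^ (2 * r ^ 2 + r) * qPochInv (q ^ 2) (n - 1 - r) *
        qPochInv (q ^ 2) (n - 1 + 1 + r) := by
  have hS := summable_weight (norm_pow_lt_one hq two_ne_zero)
    (summable_norm_zpow hq abs_le_two_mul_sq_add) (fun r => n - r) (fun r => n + r)
  have e : ∀ r : ℤ, q ^ (2 * r ^ 2 + r) * qPochInv (q ^ 2) (n - 1 - r) *
        qPochInv (q ^ 2) (n - 1 + 1 + r) =
      q ^ (2 * r ^ 2 + r) * qPochInv (q ^ 2) (n - r) * qPochInv (q ^ 2) (n + r) -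
        q ^ (2 * n) * (q ^ (2 * (-r) ^ 2 + -r) * qPochInv (q ^ 2) (n - -r) *
          qPochInv (q ^ 2) (n + -r)) := by
    intro r
    have h1 := one_sub_zpow_two_mul_qPochInv hq (n - r)
    have h4 : q ^ (2 * (n - r)) * q ^ (2 * r ^ 2 + r) =
        q ^ (2 * n) * q ^ (2 * (-r) ^ 2 + -r) := by
      rw [← zpow_add₀ hq0, ← zpow_add₀ hq0]; congr 1; ring
    rw [show n - 1 - r = n - r - 1 by ring, show n - 1 + 1 + r = n + r by ring, sub_neg_eq_add,
      ← sub_eq_add_neg n r, ← h1]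
    linear_combination (-qPochInv (q ^ 2) (n - r) * qPochInv (q ^ 2) (n + r)) * h4
  have hflip := (Equiv.neg ℤ).tsum_eq
    (fun r : ℤ => q ^ (2 * r ^ 2 + r) * qPochInv (q ^ 2) (n - r) * qPochInv (q ^ 2) (n + r))
  simp only [Equiv.neg_apply] at hflip
  rw [tsum_congr e, Summable.tsum_sub hS, tsum_mul_left, hflip]
  · ring
  · exact ((Equiv.neg ℤ).summable_iff.2 hS).mul_left _

/-- As in the even step, lowering n + 1 + r instead; the symmetry is now r ↦ -1 - r. -/
theorem baileyPair_odd_step (hq : ‖q‖ < 1) (hq0 : q ≠ 0) (n : ℤ) :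
    (1 - q ^ (2 * n + 1)) *
        ∑' r : ℤ, q ^ (2 * r ^ 2 + r) * qPochInv (q ^ 2) (n - r) * qPochInv (q ^ 2) (n + 1 + r) =
      ∑' r : ℤ, q ^ (2 * r ^ 2 + r) * qPochInv (q ^ 2) (n - r) * qPochInv (q ^ 2) (n + r) := by
  have hS := summable_weight (norm_pow_lt_one hq two_ne_zero)
    (summable_norm_zpow hq abs_le_two_mul_sq_add) (fun r => n - r) (fun r => n + 1 + r)
  have e : ∀ r : ℤ, q ^ (2 * r ^ 2 + r) * qPochInv (q ^ 2) (n - r) * qPochInv (q ^ 2) (n + r) =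
      q ^ (2 * r ^ 2 + r) * qPochInv (q ^ 2) (n - r) * qPochInv (q ^ 2) (n + 1 + r) -
        q ^ (2 * n + 1) * (q ^ (2 * (-1 - r) ^ 2 + (-1 - r)) * qPochInv (q ^ 2) (n - (-1 - r)) *
          qPochInv (q ^ 2) (n + 1 + (-1 - r))) := by
    intro r
    have h1 := one_sub_zpow_two_mul_qPochInv hq (n + 1 + r)
    have h4 : q ^ (2 * (n + 1 + r)) * q ^ (2 * r ^ 2 + r) =
        q ^ (2 * n + 1) * q ^ (2 * (-1 - r) ^ 2 + (-1 - r)) := by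
      rw [← zpow_add₀ hq0, ← zpow_add₀ hq0]; congr 1; ring
    rw [show n + r = n + 1 + r - 1 by ring, show n - (-1 - r) = n + 1 + r by ring,
      show n + 1 + (-1 - r) = n - r by ring, ← h1]
    linear_combination (-qPochInv (q ^ 2) (n - r) * qPochInv (q ^ 2) (n + 1 + r)) * h4
  have hflip := (Equiv.subLeft (-1 : ℤ)).tsum_eq
    (fun r : ℤ => q ^ (2 * r ^ 2 + r) * qPochInv (q ^ 2) (n - r) * qPochInv (q ^ 2) (n + 1 + r))
  simp only [Equiv.subLeft_apply] at hflip
  rw [tsum_congr e, Summable.tsum_sub hS, tsum_mul_left, hflip]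
  · ring
  · exact ((Equiv.subLeft (-1 : ℤ)).summable_iff.2 hS).mul_left _

theorem baileyPair_odd_of_even (hq : ‖q‖ < 1) (hq0 : q ≠ 0) (n : ℕ)
    (h : ∑' r : ℤ, q ^ (2 * r ^ 2 + r) * qPochInv (q ^ 2) (n - r) * qPochInv (q ^ 2) (n + r) =
      (qPoch q (q ^ 2) n * qPoch (q ^ 2) (q ^ 2) n)⁻¹) :
    ∑' r : ℤ, q ^ (2 * r ^ 2 + r) * qPochInv (q ^ 2) (n - r) * qPochInv (q ^ 2) (n + 1 + r) =
      (qPoch q (q ^ 2) (n + 1) * qPoch (q ^ 2) (q ^ 2) n)⁻¹ := by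
  have h1 := baileyPair_odd_step hq hq0 n
  have h2 := one_sub_mul_pow_ne_zero hq (norm_pow_lt_one hq two_ne_zero) n
  have h3 : q ^ (2 * (n : ℤ) + 1) = q * (q ^ 2) ^ n := by
    rw [← pow_mul, ← pow_succ']
    norm_cast
  rw [h, h3] at h1
  rw [qPoch_succ, mul_right_comm, mul_inv, ← h1]
  field_simp

theorem baileyPair_even (hq : ‖q‖ < 1) (hq0 : q ≠ 0) (n : ℕ) :
    ∑' r : ℤ, q ^ (2 * r ^ 2 + r) * qPochInv (q ^ 2) (n - r) * qPochInv (q ^ 2) (n + r) =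
      (qPoch q (q ^ 2) n * qPoch (q ^ 2) (q ^ 2) n)⁻¹ := by
  induction n with
  | zero =>
    simp only [Nat.cast_zero]
    rw [tsum_qPochInv_zero (w := fun r : ℤ => q ^ (2 * r ^ 2 + r)) (by simp)]
    simp [qPoch]
  | succ n ih =>
    have h1 := baileyPair_even_step hq hq0 (n + 1)
    rw [add_sub_cancel_right, baileyPair_odd_of_even hq hq0 n ih] at h1
    have hp := norm_pow_lt_one hq two_ne_zero
    have h2 := one_sub_mul_pow_ne_zero hp hp n
    have h3 : q ^ (2 * ((n : ℤ) + 1)) = q ^ 2 * (q ^ 2) ^ n := by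
      rw [← pow_mul, ← pow_add]
      norm_cast
      congr 1
      ring
    rw [h3] at h1
    push_cast
    rw [qPoch_succ (q ^ 2), ← mul_assoc, mul_inv _ (1 - q ^ 2 * (q ^ 2) ^ n), ← h1]
    field_simp

theorem baileyPair_odd (hq : ‖q‖ < 1) (hq0 : q ≠ 0) (n : ℕ) :
    ∑' r : ℤ, q ^ (2 * r ^ 2 + r) * qPochInv (q ^ 2) (n - r) * qPochInv (q ^ 2) (n + 1 + r) =
      (qPoch q (q ^ 2) (n + 1) * qPoch (q ^ 2) (q ^ 2) n)⁻¹ :=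
  baileyPair_odd_of_even hq hq0 n (baileyPair_even hq hq0 n)

end BaileyPair

/-! ### The conjugate Bailey pairs -/

section ConjugatePair

variable {q : ℂ}

theorem summable_conjugate (hq : ‖q‖ < 1) (hq0 : q ≠ 0) (s : ℕ) (c : ℤ) (f g : ℕ → ℤ) :
    Summable fun n : ℕ => qPoch (-q) (q ^ 2) n * q ^ ((n : ℤ) ^ 2 + 2 * s * n + c) *
      qPochInv (q ^ 2) (f n) * qPochInv (q ^ 2) (g n) := by
  have hp := norm_pow_lt_one hq two_ne_zero
  obtain ⟨C, hC, h⟩ := exists_norm_qPochInv_le hp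
  obtain ⟨B, hB, hb⟩ := exists_norm_qPoch_le (-q) hp
  have hs : Summable fun n : ℕ => B * (‖q‖ ^ (n ^ 2 + 2 * s * n) * ‖q ^ c‖) * C * C :=
    ((((summable_pow_of_lt (norm_nonneg q) hq fun n => by nlinarith [Nat.zero_le (2 * s * n)]
      ).mul_right _).mul_left _).mul_right _).mul_right _
  refine Summable.of_norm_bounded hs fun n => ?_
  have e : q ^ ((n : ℤ) ^ 2 + 2 * s * n + c) = q ^ (n ^ 2 + 2 * s * n) * q ^ c := by
    rw [zpow_add₀ hq0]
    norm_cast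
  rw [e, norm_mul, norm_mul, norm_mul, norm_mul, norm_pow]
  gcongr
  · exact hb _
  · exact h _
  · exact h _

/-- A telescoping certificate: the difference of the summands at r and r + 1 is a forward difference
in n, so the sum over n does not depend on r ≥ 0. -/
theorem conjugate_certificate (hq : ‖q‖ < 1) (hq0 : q ≠ 0) (r : ℤ) (n : ℕ) :
    qPoch (-q) (q ^ 2) n * q ^ ((n : ℤ) ^ 2 - r ^ 2) *
        qPochInv (q ^ 2) (n - r) * qPochInv (q ^ 2) (n + r) -
      qPoch (-q) (q ^ 2) n * q ^ ((n : ℤ) ^ 2 - (r + 1) ^ 2) *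
        qPochInv (q ^ 2) (n - (r + 1)) * qPochInv (q ^ 2) (n + (r + 1)) =
    (1 - q ^ (2 * r + 1)) *
      (qPoch (-q) (q ^ 2) (n + 1) * q ^ (((n + 1 : ℕ) : ℤ) ^ 2 - (r + 1) ^ 2) *
          qPochInv (q ^ 2) ((n + 1 : ℕ) - r - 1) * qPochInv (q ^ 2) ((n + 1 : ℕ) + r) -
        qPoch (-q) (q ^ 2) n * q ^ ((n : ℤ) ^ 2 - (r + 1) ^ 2) *
          qPochInv (q ^ 2) (n - r - 1) * qPochInv (q ^ 2) (n + r)) := by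
  have h1 := one_sub_zpow_two_mul_qPochInv hq (n - r)
  have h2 := one_sub_zpow_two_mul_qPochInv hq (n + r + 1)
  rw [add_sub_cancel_right] at h2
  push_cast
  rw [show (n : ℤ) - (r + 1) = n - r - 1 by ring, show (n : ℤ) + (r + 1) = n + r + 1 by ring,
    show (n : ℤ) + 1 - r - 1 = n - r by ring, show (n : ℤ) + 1 + r = n + r + 1 by ring, ← h1, ← h2,
    qPoch_succ]
  generalize qPochInv (q ^ 2) (n - r) = A
  generalize qPochInv (q ^ 2) (n + r + 1) = B
  generalize qPoch (-q) (q ^ 2) n = a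
  have e1 : q ^ (2 * ((n : ℤ) - r)) = (q ^ n) ^ 2 / (q ^ r) ^ 2 := by
    rw [mul_comm, zpow_mul, zpow_sub₀ hq0, zpow_natCast, ← div_pow]
    norm_cast
  have e2 : q ^ (2 * ((n : ℤ) + r + 1)) = (q ^ n) ^ 2 * (q ^ r) ^ 2 * q ^ 2 := by
    rw [mul_comm, zpow_mul, zpow_add₀ hq0, zpow_add₀ hq0, zpow_natCast, ← mul_pow, zpow_one,
      ← mul_pow]
    norm_cast
  have e3 : q ^ (2 * r + 1) = q * (q ^ r) ^ 2 := by
    rw [zpow_add₀ hq0, zpow_one, mul_comm 2 r, zpow_mul, mul_comm]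
    norm_cast
  have e4 : (q ^ 2) ^ n = (q ^ n) ^ 2 := by rw [← pow_mul, mul_comm, pow_mul]
  have e5 : q ^ ((n : ℤ) ^ 2 - (r + 1) ^ 2) =
      q ^ ((n : ℤ) ^ 2 - r ^ 2) / (q * (q ^ r) ^ 2) := by
    rw [← e3, ← zpow_sub₀ hq0]
    congr 1
    ring
  have e6 : q ^ (((n : ℤ) + 1) ^ 2 - (r + 1) ^ 2) =
      q ^ ((n : ℤ) ^ 2 - r ^ 2) * ((q ^ n) ^ 2 / (q ^ r) ^ 2) := by
    rw [← e1, ← zpow_add₀ hq0]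
    congr 1
    ring
  rw [e1, e2, e3, e4, e5, e6]
  have hY : q ^ r ≠ 0 := zpow_ne_zero _ hq0
  field_simp
  ring

theorem tsum_conjugate_succ (hq : ‖q‖ < 1) (hq0 : q ≠ 0) (r : ℕ) :
    ∑' n : ℕ, qPoch (-q) (q ^ 2) n * q ^ ((n : ℤ) ^ 2 - ((r + 1 : ℕ) : ℤ) ^ 2) *
        qPochInv (q ^ 2) (n - (r + 1 : ℕ)) * qPochInv (q ^ 2) (n + (r + 1 : ℕ)) =
      ∑' n : ℕ, qPoch (-q) (q ^ 2) n * q ^ ((n : ℤ) ^ 2 - (r : ℤ) ^ 2) *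
        qPochInv (q ^ 2) (n - r) * qPochInv (q ^ 2) (n + r) := by
  have hS : ∀ (c : ℤ) (f g : ℕ → ℤ), Summable fun n : ℕ =>
      qPoch (-q) (q ^ 2) n * q ^ ((n : ℤ) ^ 2 - c) * qPochInv (q ^ 2) (f n) *
        qPochInv (q ^ 2) (g n) := fun c f g => by
    simpa [sub_eq_add_neg] using summable_conjugate hq hq0 0 (-c) f g
  have hg := hS ((r + 1) ^ 2) (fun n => n - r - 1) (fun n => n + r)
  have h0 := hg.tsum_eq_zero_add
  -- The telescoping boundary term at n = 0 has the negative index -r - 1, hence vanishes.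
  rw [qPochInv_of_neg _ (show ((0 : ℕ) : ℤ) - r - 1 < 0 by omega), mul_zero, zero_mul,
    zero_add] at h0
  push_cast
  rw [eq_comm, ← sub_eq_zero, ← Summable.tsum_sub (hS _ _ _) (hS _ _ _),
    tsum_congr (conjugate_certificate hq hq0 r), tsum_mul_left,
    Summable.tsum_sub ((summable_nat_add_iff 1).2 hg) hg, ← h0, sub_self, mul_zero]

/-- The terms with n < r vanish. Shifting n by r exposes the factor q^{2nr}, which makes the limit r
→ ∞ accessible. -/
theorem tsum_conjugate_eq_shift (hq : ‖q‖ < 1) (hq0 : q ≠ 0) (r : ℕ) :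
    ∑' n : ℕ, qPoch (-q) (q ^ 2) n * q ^ ((n : ℤ) ^ 2 - (r : ℤ) ^ 2) *
        qPochInv (q ^ 2) (n - r) * qPochInv (q ^ 2) (n + r) =
      ∑' n : ℕ, qPoch (-q) (q ^ 2) (n + r) * (q ^ n ^ 2 * (q ^ (2 * n)) ^ r) *
        qPochInv (q ^ 2) n * qPochInv (q ^ 2) (n + 2 * r) := by
  have hS := summable_conjugate hq hq0 0 (-(r : ℤ) ^ 2) (fun n => n - r) (fun n => n + r)
  simp only [Nat.cast_zero, mul_zero, zero_mul, add_zero, ← sub_eq_add_neg] at hS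
  rw [← hS.sum_add_tsum_nat_add r, Finset.sum_eq_zero, zero_add]
  · refine tsum_congr fun n => ?_
    have e : q ^ (((n + r : ℕ) : ℤ) ^ 2 - (r : ℤ) ^ 2) = q ^ n ^ 2 * (q ^ (2 * n)) ^ r := by
      rw [← pow_mul, ← pow_add, ← zpow_natCast]
      congr 1
      push_cast
      ring
    rw [e]
    push_cast
    rw [add_sub_cancel_right, show (n : ℤ) + r + r = n + 2 * r by ring]
  · intro i hi
    rw [qPochInv_of_neg _ (show (i : ℤ) - r < 0 by have := Finset.mem_range.1 hi; omega), mul_zero,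
      zero_mul]

/-- Since q^{2nr} → 0 for n > 0, only the n = 0 term survives in the limit. -/
theorem tendsto_tsum_conjugate (hq : ‖q‖ < 1) :
    Tendsto (fun r : ℕ => ∑' n : ℕ, qPoch (-q) (q ^ 2) (n + r) *
        (q ^ n ^ 2 * (q ^ (2 * n)) ^ r) * qPochInv (q ^ 2) n * qPochInv (q ^ 2) (n + 2 * r)) atTop
      (𝓝 (qPochInf (-q) (q ^ 2) * (qPochInf (q ^ 2) (q ^ 2))⁻¹)) := by
  have hp := norm_pow_lt_one hq two_ne_zero
  obtain ⟨C, hC, h⟩ := exists_norm_qPochInv_le hp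
  obtain ⟨B, hB, hb⟩ := exists_norm_qPoch_le (-q) hp
  have hlim : ∑' n : ℕ, qPochInf (-q) (q ^ 2) * (q ^ n ^ 2 * if n = 0 then 1 else 0) *
      qPochInv (q ^ 2) n * (qPochInf (q ^ 2) (q ^ 2))⁻¹ =
      qPochInf (-q) (q ^ 2) * (qPochInf (q ^ 2) (q ^ 2))⁻¹ := by
    rw [tsum_eq_single 0]
    · simp [qPochInv, qPoch]
    · intro n hn
      simp [hn]
  rw [← hlim]
  have hs : Summable fun n : ℕ => B * ‖q‖ ^ n ^ 2 * C * C :=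
    ((((summable_pow_of_lt (norm_nonneg q) hq fun n => by nlinarith)).mul_left _).mul_right
      _).mul_right _
  have hcast : Tendsto (fun r : ℕ => (r : ℤ)) atTop atTop := tendsto_natCast_atTop_atTop
  refine tendsto_tsum_of_dominated_convergence hs (fun n => ?_)
    (Eventually.of_forall fun r n => ?_)
  · refine Tendsto.mul (Tendsto.mul (Tendsto.mul ?_ (Tendsto.mul tendsto_const_nhds ?_))
      tendsto_const_nhds) ?_
    · exact (tendsto_qPoch _ hp).comp (tendsto_atTop_mono (fun r => Nat.le_add_left r n) tendsto_id)
    · split_ifs with hn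
      · exact tendsto_const_nhds.congr fun r => by simp [hn]
      · exact tendsto_pow_atTop_nhds_zero_of_norm_lt_one (norm_pow_lt_one hq (by omega))
    · exact (tendsto_qPochInv hp).comp
        (tendsto_atTop_add_const_left _ _ (hcast.const_mul_atTop' two_pos))
  · rw [norm_mul, norm_mul, norm_mul, norm_mul, norm_pow]
    have h1 : ‖(q ^ (2 * n)) ^ r‖ ≤ 1 := by
      rw [norm_pow, norm_pow]
      exact pow_le_one₀ (by positivity) (pow_le_one₀ (norm_nonneg _) hq.le)
    gcongr
    · exact hb _
    · exact mul_le_of_le_one_right (by positivity) h1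
    · exact h _
    · exact h _

/-- A sequence constant in r equals its limit. -/
theorem tsum_conjugate_sub (hq : ‖q‖ < 1) (hq0 : q ≠ 0) (r : ℕ) :
    ∑' n : ℕ, qPoch (-q) (q ^ 2) n * q ^ ((n : ℤ) ^ 2 - (r : ℤ) ^ 2) *
        qPochInv (q ^ 2) (n - r) * qPochInv (q ^ 2) (n + r) =
      qPochInf (-q) (q ^ 2) * (qPochInf (q ^ 2) (q ^ 2))⁻¹ := by
  set e : ℕ → ℂ := fun r => ∑' n : ℕ, qPoch (-q) (q ^ 2) n * q ^ ((n : ℤ) ^ 2 - (r : ℤ) ^ 2) *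
        qPochInv (q ^ 2) (n - r) * qPochInv (q ^ 2) (n + r) with he
  have hsucc : ∀ r, e (r + 1) = e r := tsum_conjugate_succ hq hq0
  have hconst : ∀ r, e r = e 0 := fun r => by
    induction r with
    | zero => rfl
    | succ r ih => rw [hsucc, ih]
  have hl := (tendsto_tsum_conjugate hq).congr fun r => (tsum_conjugate_eq_shift hq hq0 r).symm
  have h1 : Tendsto e atTop (𝓝 (e 0)) := tendsto_const_nhds.congr fun r => (hconst r).symm
  have := tendsto_nhds_unique h1 hl
  rw [← this]
  exact hconst r

theorem tsum_conjugate_even (hq : ‖q‖ < 1) (hq0 : q ≠ 0) (r : ℤ) :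
    ∑' n : ℕ, qPoch (-q) (q ^ 2) n * q ^ n ^ 2 *
        qPochInv (q ^ 2) (n - r) * qPochInv (q ^ 2) (n + r) =
      q ^ r ^ 2 * (qPochInf (-q) (q ^ 2) * (qPochInf (q ^ 2) (q ^ 2))⁻¹) := by
  have key : ∀ r : ℕ, ∑' n : ℕ, qPoch (-q) (q ^ 2) n * q ^ n ^ 2 *
        qPochInv (q ^ 2) (n - r) * qPochInv (q ^ 2) (n + r) =
      q ^ r ^ 2 * (qPochInf (-q) (q ^ 2) * (qPochInf (q ^ 2) (q ^ 2))⁻¹) := by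
    intro r
    rw [← tsum_conjugate_sub hq hq0 r, ← tsum_mul_left]
    refine tsum_congr fun n => ?_
    have e : q ^ r ^ 2 * q ^ ((n : ℤ) ^ 2 - (r : ℤ) ^ 2) = q ^ n ^ 2 := by
      rw [← zpow_natCast, ← zpow_natCast, ← zpow_add₀ hq0]
      congr 1
      push_cast
      ring
    rw [← e]
    ring
  obtain ⟨k, rfl | rfl⟩ := r.eq_nat_or_neg
  · rw [key]
    norm_cast
  · rw [neg_sq, show q ^ (k : ℤ) ^ 2 = q ^ k ^ 2 by norm_cast, ← key]
    refine tsum_congr fun n => ?_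
    rw [sub_neg_eq_add, ← sub_eq_add_neg]
    ring

theorem one_sub_zpow_ne_zero_of_ne (hq : ‖q‖ < 1) {n : ℤ} (hn : n ≠ 0) :
    1 - q ^ n ≠ 0 := by
  rcases lt_or_gt_of_ne hn with h | h
  · have h1 := one_sub_zpow_ne_zero hq (show 0 < -n by omega)
    rw [zpow_neg] at h1
    intro h2
    rw [← sub_eq_zero.1 h2] at h1
    simp at h1
  · exact one_sub_zpow_ne_zero hq h

/-- Subtract the even evaluations at r and r + 1. Termwise the difference yields q^{2n} (q^{-2r} -
q^{2r+2}) times the odd kernel. This constant contains 1 - q^{4r+2}, while the right side contains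
only 1 - q^{2r+1}; cancelling leaves 1 + q^{2r+1}. -/
theorem tsum_conjugate_odd (hq : ‖q‖ < 1) (hq0 : q ≠ 0) (r : ℤ) :
    (1 + q ^ (2 * r + 1)) * ∑' n : ℕ, qPoch (-q) (q ^ 2) n * q ^ (n ^ 2 + 2 * n) *
        qPochInv (q ^ 2) (n - r) * qPochInv (q ^ 2) (n + 1 + r) =
      q ^ (r ^ 2 + 2 * r) * (qPochInf (-q) (q ^ 2) * (qPochInf (q ^ 2) (q ^ 2))⁻¹) := by
  have hS : ∀ f g : ℕ → ℤ, Summable fun n : ℕ => qPoch (-q) (q ^ 2) n * q ^ n ^ 2 *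
      qPochInv (q ^ 2) (f n) * qPochInv (q ^ 2) (g n) := fun f g => by
    have := summable_conjugate hq hq0 0 0 f g
    simp only [Nat.cast_zero, mul_zero, zero_mul, add_zero] at this
    exact_mod_cast this
  have e : ∀ n : ℕ, qPoch (-q) (q ^ 2) n * q ^ n ^ 2 *
        qPochInv (q ^ 2) (n - r) * qPochInv (q ^ 2) (n + r) -
      qPoch (-q) (q ^ 2) n * q ^ n ^ 2 *
        qPochInv (q ^ 2) (n - (r + 1)) * qPochInv (q ^ 2) (n + (r + 1)) =
      (1 / (q ^ r) ^ 2 - (q ^ r) ^ 2 * q ^ 2) * (qPoch (-q) (q ^ 2) n * q ^ (n ^ 2 + 2 * n) *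
        qPochInv (q ^ 2) (n - r) * qPochInv (q ^ 2) (n + 1 + r)) := by
    intro n
    have h1 := one_sub_zpow_two_mul_qPochInv hq (n - r)
    have h2 := one_sub_zpow_two_mul_qPochInv hq (n + r + 1)
    rw [add_sub_cancel_right] at h2
    have e1 : q ^ (2 * ((n : ℤ) - r)) = (q ^ n) ^ 2 / (q ^ r) ^ 2 := by
      rw [mul_comm, zpow_mul, zpow_sub₀ hq0, zpow_natCast, ← div_pow]
      norm_cast
    have e2 : q ^ (2 * ((n : ℤ) + r + 1)) = (q ^ n) ^ 2 * (q ^ r) ^ 2 * q ^ 2 := by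
      rw [mul_comm, zpow_mul, zpow_add₀ hq0, zpow_add₀ hq0, zpow_natCast, ← mul_pow, zpow_one,
        ← mul_pow]
      norm_cast
    rw [show (n : ℤ) - (r + 1) = n - r - 1 by ring, show (n : ℤ) + (r + 1) = n + r + 1 by ring,
      show (n : ℤ) + 1 + r = n + r + 1 by ring, ← h1, ← h2, e1, e2, pow_add, mul_comm 2 n,
      pow_mul q n 2]
    ring
  have h1 := Summable.tsum_sub (hS (fun n => n - r) (fun n => n + r))
    (hS (fun n => n - (r + 1)) (fun n => n + (r + 1)))
  rw [tsum_congr e, tsum_mul_left, tsum_conjugate_even hq hq0, tsum_conjugate_even hq hq0] at h1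
  have e3 : q ^ (2 * r + 1) = q * (q ^ r) ^ 2 := by
    rw [zpow_add₀ hq0, zpow_one, mul_comm 2 r, zpow_mul, mul_comm]
    norm_cast
  have e4 : q ^ (r + 1) ^ 2 = q ^ r ^ 2 * (q * (q ^ r) ^ 2) := by
    rw [← e3, ← zpow_add₀ hq0]
    congr 1
    ring
  have e5 : q ^ (r ^ 2 + 2 * r) = q ^ r ^ 2 * (q ^ r) ^ 2 := by
    rw [zpow_add₀ hq0, mul_comm 2 r, zpow_mul q r 2]
    norm_cast
  have h3 := one_sub_zpow_ne_zero_of_ne hq (show 2 * r + 1 ≠ 0 by omega)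
  have hY : q ^ r ≠ 0 := zpow_ne_zero _ hq0
  apply mul_left_cancel₀ h3
  rw [e3, e5]
  rw [e4] at h1
  have h4 : (1 / (q ^ r) ^ 2 - (q ^ r) ^ 2 * q ^ 2) * (q ^ r) ^ 2 =
      (1 - q * (q ^ r) ^ 2) * (1 + q * (q ^ r) ^ 2) := by
    field_simp
    ring
  rw [← mul_assoc, ← h4]
  linear_combination (q ^ r) ^ 2 * h1

end ConjugatePair

/-! ### The contiguous relation and the evaluation of S_0 and S_1 -/

section SlaterIdentities

variable {q : ℂ}

/-- The summand of the left-hand side. -/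
def slaterTerm (q : ℂ) (m n : ℕ) : ℂ :=
  qPoch (-q) (q ^ 2) n * q ^ (n ^ 2 + 2 * m * n) /
    (qPoch q (q ^ 2) (m + n) * qPoch (q ^ 2) (q ^ 2) n)

theorem summable_slaterTerm (hq : ‖q‖ < 1) (m : ℕ) : Summable (slaterTerm q m) := by
  have hp := norm_pow_lt_one hq two_ne_zero
  obtain ⟨A, hA, ha⟩ := exists_norm_qPoch_le (-q) hp
  obtain ⟨B, hB, hb⟩ := exists_norm_qPoch_inv_le hq hp
  obtain ⟨C, hC, hc⟩ := exists_norm_qPoch_inv_le hp hp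
  have hs : Summable fun n : ℕ => A * ‖q‖ ^ (n ^ 2 + 2 * m * n) * (B * C) :=
    ((summable_pow_of_lt (norm_nonneg q) hq fun n => by nlinarith [Nat.zero_le (2 * m * n)]
      ).mul_left _).mul_right _
  refine Summable.of_norm_bounded hs fun n => ?_
  rw [slaterTerm, div_eq_mul_inv, mul_inv, norm_mul, norm_mul, norm_mul, norm_pow]
  gcongr
  · exact ha _
  · exact hb _
  · exact hc _

theorem tsum_slaterTerm_sub (hq : ‖q‖ < 1) (m : ℕ) :
    ∑' n, slaterTerm q m n - ∑' n, slaterTerm q (m + 1) n =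
      (q ^ 2) ^ (m + 1) * (1 + (q ^ 2) ^ (m + 1)) * ∑' n, slaterTerm q (m + 2) n := by
  have hp := norm_pow_lt_one hq two_ne_zero
  have hA := one_sub_mul_pow_ne_zero hq hp
  have hB := one_sub_mul_pow_ne_zero hp hp
  have e0 : slaterTerm q m 0 = (1 - q * (q ^ 2) ^ m) * slaterTerm q (m + 1) 0 := by
    have h1 := hA m
    have h2 := qPoch_ne_zero hA m
    simp only [slaterTerm, add_zero, qPoch_succ, qPoch_zero]
    field_simp
    ring
  -- The weights 1 - q^{2m+1} and q^{2m+1} add to 1, so after summation the two middle terms combine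
  -- to S_{m+1}; `e0` supplies the missing n = 0 term.
  have e1 : ∀ n, slaterTerm q m (n + 1) =
      (q ^ 2) ^ (m + 1) * (1 + (q ^ 2) ^ (m + 1)) * slaterTerm q (m + 2) n +
        (1 - q * (q ^ 2) ^ m) * slaterTerm q (m + 1) (n + 1) +
        q * (q ^ 2) ^ m * slaterTerm q (m + 1) n := by
    intro n
    have h1 := hA (m + n)
    have h1' := hA (m + n + 1)
    have h2 := qPoch_ne_zero hA (m + n)
    have h3 := qPoch_ne_zero hB n
    have h4 := hB n
    simp only [slaterTerm]
    rw [show m + (n + 1) = m + n + 1 by ring, show m + 2 + n = m + n + 1 + 1 by ring,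
      show m + 1 + (n + 1) = m + n + 1 + 1 by ring, show m + 1 + n = m + n + 1 by ring]
    simp only [qPoch_succ]
    have h5 : q ^ ((n + 1) ^ 2 + 2 * m * (n + 1)) =
        q ^ (n ^ 2 + 2 * m * n) * ((q ^ 2) ^ n * (q ^ 2) ^ m * q) := by ring
    have h6 : q ^ (n ^ 2 + 2 * (m + 2) * n) = q ^ (n ^ 2 + 2 * m * n) * ((q ^ 2) ^ n) ^ 2 := by
      ring
    have h7 : q ^ ((n + 1) ^ 2 + 2 * (m + 1) * (n + 1)) =
        q ^ (n ^ 2 + 2 * m * n) * (((q ^ 2) ^ n) ^ 2 * (q ^ 2) ^ m * q ^ 3) := by ring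
    have h8 : q ^ (n ^ 2 + 2 * (m + 1) * n) = q ^ (n ^ 2 + 2 * m * n) * (q ^ 2) ^ n := by
      ring
    rw [h5, h6, h7, h8]
    simp only [pow_add _ m n, pow_succ (q ^ 2)] at h1 h1' h4 ⊢
    generalize q ^ (n ^ 2 + 2 * m * n) = T at *
    generalize (q ^ 2) ^ n = X at *
    generalize (q ^ 2) ^ m = Y at *
    have h9 : 1 - q * X * Y ≠ 0 := by convert h1 using 2; ring
    have h10 : 1 - q ^ 3 * X * Y ≠ 0 := by convert h1' using 2; ring
    rw [show 1 - q * (Y * X) = 1 - q * X * Y by ring,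
      show 1 - q * (Y * X * q ^ 2) = 1 - q ^ 3 * X * Y by ring]
    field_simp
    ring
  have hS := summable_slaterTerm hq
  have hS' : ∀ m, Summable fun n => slaterTerm q m (n + 1) := fun m =>
    (summable_nat_add_iff 1).2 (hS m)
  have h1 := (hS m).tsum_eq_zero_add
  have h2 := (hS (m + 1)).tsum_eq_zero_add
  rw [tsum_congr e1, Summable.tsum_add (((hS _).mul_left _).add ((hS' _).mul_left _))
    ((hS _).mul_left _), Summable.tsum_add ((hS _).mul_left _) ((hS' _).mul_left _),
    tsum_mul_left, tsum_mul_left, tsum_mul_left] at h1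
  linear_combination h1 + e0 - (1 - q * (q ^ 2) ^ m) * h2

theorem summable_double (hq : ‖q‖ < 1) (s : ℕ) {w : ℤ → ℂ} (hw : Summable fun r => ‖w r‖)
    (f g : ℕ → ℤ → ℤ) :
    Summable (Function.uncurry fun (n : ℕ) (r : ℤ) =>
      qPoch (-q) (q ^ 2) n * q ^ (n ^ 2 + s * n) *
        (w r * qPochInv (q ^ 2) (f n r) * qPochInv (q ^ 2) (g n r))) := by
  have hp := norm_pow_lt_one hq two_ne_zero
  obtain ⟨C, hC, h⟩ := exists_norm_qPochInv_le hp
  obtain ⟨B, hB, hb⟩ := exists_norm_qPoch_le (-q) hp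
  have hs : Summable fun n : ℕ => B * ‖q‖ ^ (n ^ 2 + s * n) * (C * C) :=
    ((summable_pow_of_lt (norm_nonneg q) hq fun n => by nlinarith [Nat.zero_le (s * n)]
      ).mul_left _).mul_right _
  refine Summable.of_norm_bounded (hs.mul_of_nonneg hw (fun n => by positivity)
    fun r => norm_nonneg _) fun ⟨n, r⟩ => ?_
  simp only [Function.uncurry_apply_pair]
  rw [norm_mul, norm_mul, norm_mul, norm_mul, norm_pow]
  have h1 : ‖qPoch (-q) (q ^ 2) n‖ * ‖q‖ ^ (n ^ 2 + s * n) *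
      (‖w r‖ * ‖qPochInv (q ^ 2) (f n r)‖ * ‖qPochInv (q ^ 2) (g n r)‖) ≤
      B * ‖q‖ ^ (n ^ 2 + s * n) * (‖w r‖ * C * C) := by
    gcongr
    · exact hb _
    · exact h _
    · exact h _
  exact h1.trans_eq (by ring)

/-- Bailey's transform. The exchange is legitimate because q^{n²+sn} and `w` are absolutely summable
and all other factors are bounded. -/
theorem hasSum_swap (hq : ‖q‖ < 1) (s : ℕ) {w : ℤ → ℂ} (hw : Summable fun r => ‖w r‖)
    (f g : ℕ → ℤ → ℤ) :
    HasSum (fun r => w r * ∑' n : ℕ, qPoch (-q) (q ^ 2) n * q ^ (n ^ 2 + s * n) *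
        qPochInv (q ^ 2) (f n r) * qPochInv (q ^ 2) (g n r))
      (∑' n : ℕ, qPoch (-q) (q ^ 2) n * q ^ (n ^ 2 + s * n) *
        ∑' r, w r * qPochInv (q ^ 2) (f n r) * qPochInv (q ^ 2) (g n r)) := by
  have hS := summable_double hq s hw f g
  have h1 := hS.prod_symm.prod
  have h2 := hS.tsum_comm
  have e : ∀ r, w r * ∑' n : ℕ, qPoch (-q) (q ^ 2) n * q ^ (n ^ 2 + s * n) *
        qPochInv (q ^ 2) (f n r) * qPochInv (q ^ 2) (g n r) =
      ∑' n : ℕ, qPoch (-q) (q ^ 2) n * q ^ (n ^ 2 + s * n) *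
        (w r * qPochInv (q ^ 2) (f n r) * qPochInv (q ^ 2) (g n r)) := fun r => by
    rw [← tsum_mul_left]
    exact tsum_congr fun n => by ring
  have e' : ∀ n : ℕ, qPoch (-q) (q ^ 2) n * q ^ (n ^ 2 + s * n) *
        ∑' r, w r * qPochInv (q ^ 2) (f n r) * qPochInv (q ^ 2) (g n r) =
      ∑' r, qPoch (-q) (q ^ 2) n * q ^ (n ^ 2 + s * n) *
        (w r * qPochInv (q ^ 2) (f n r) * qPochInv (q ^ 2) (g n r)) := fun n =>
    tsum_mul_left.symm
  rw [tsum_congr e', ← h2]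
  simp_rw [e]
  exact h1.hasSum

theorem tsum_slaterTerm_zero (hq : ‖q‖ < 1) (hq0 : q ≠ 0) :
    ∑' n, slaterTerm q 0 n = (∑' r : ℤ, q ^ (3 * r ^ 2 + r)) *
      (qPochInf (-q) (q ^ 2) * (qPochInf (q ^ 2) (q ^ 2))⁻¹) := by
  have h := hasSum_swap hq 0 (summable_norm_zpow hq abs_le_two_mul_sq_add)
    (fun n r => n - r) (fun n r => n + r)
  simp only [zero_mul, add_zero] at h
  simp_rw [tsum_conjugate_even hq hq0] at h
  calc _ = _ := tsum_congr fun n => by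
        rw [baileyPair_even hq hq0, slaterTerm, div_eq_mul_inv]
        simp
    _ = _ := h.tsum_eq.symm
    _ = _ := by
        rw [← tsum_mul_right]
        refine tsum_congr fun r => ?_
        rw [← mul_assoc, ← zpow_add₀ hq0]
        congr 2
        ring

/-- The transform produces ∑ q^{3r²+3r} / (1 + q^{2r+1}), which is not yet a theta series. Averaging
over r ↦ -1 - r removes the denominator, as 1/(1+y) + 1/(1+y⁻¹) = 1; this is the source of the
factor 2. -/
theorem tsum_slaterTerm_one (hq : ‖q‖ < 1) (hq0 : q ≠ 0) :
    2 * ∑' n, slaterTerm q 1 n = (∑' r : ℤ, q ^ (3 * r ^ 2 + 3 * r)) *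
      (qPochInf (-q) (q ^ 2) * (qPochInf (q ^ 2) (q ^ 2))⁻¹) := by
  set K := qPochInf (-q) (q ^ 2) * (qPochInf (q ^ 2) (q ^ 2))⁻¹ with hK
  have hne : ∀ r : ℤ, 1 + q ^ (2 * r + 1) ≠ 0 := fun r h0 => by
    have h1 := one_sub_zpow_ne_zero_of_ne hq (show (2 * r + 1) * 2 ≠ 0 by omega)
    rw [zpow_mul] at h1
    apply h1
    have : (q ^ (2 * r + 1)) ^ (2 : ℤ) = (q ^ (2 * r + 1)) ^ 2 := by norm_cast
    rw [this]
    linear_combination (1 - q ^ (2 * r + 1)) * h0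
  have h := hasSum_swap hq 2 (summable_norm_zpow hq abs_le_two_mul_sq_add)
    (fun n r => n - r) (fun n r => n + 1 + r)
  have hG : HasSum (fun r : ℤ => q ^ (3 * r ^ 2 + 3 * r) / (1 + q ^ (2 * r + 1)) * K)
      (∑' n, slaterTerm q 1 n) := by
    convert h using 1
    · funext r
      have h1 := tsum_conjugate_odd hq hq0 r
      rw [← hK] at h1
      have h2 : q ^ (3 * r ^ 2 + 3 * r) = q ^ (2 * r ^ 2 + r) * q ^ (r ^ 2 + 2 * r) := by
        rw [← zpow_add₀ hq0]
        congr 1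
        ring
      rw [h2, div_mul_eq_mul_div, div_eq_iff (hne r), mul_assoc, ← h1]
      ring
    · refine tsum_congr fun n => ?_
      rw [baileyPair_odd hq hq0, slaterTerm, div_eq_mul_inv, add_comm 1 _, mul_one]
  have hflip := (Equiv.subLeft (-1 : ℤ)).hasSum_iff.2 hG
  have hsum := hG.add hflip
  rw [two_mul, ← hsum.tsum_eq, ← tsum_mul_right]
  refine tsum_congr fun r => ?_
  have h1 := hne r
  have h2 : q ^ (2 * r + 1) ≠ 0 := zpow_ne_zero _ hq0
  have h3 : (1 : ℂ) + (q ^ (2 * r + 1))⁻¹ ≠ 0 := by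
    have := hne (-1 - r)
    rwa [show 2 * (-1 - r) + 1 = -(2 * r + 1) by ring, zpow_neg] at this
  simp only [Function.comp_apply, Equiv.subLeft_apply]
  rw [show 2 * (-1 - r) + 1 = -(2 * r + 1) by ring,
    show 3 * (-1 - r) ^ 2 + 3 * (-1 - r) = 3 * r ^ 2 + 3 * r by ring, zpow_neg]
  have h4 : 1 / (1 + q ^ (2 * r + 1)) + 1 / (1 + (q ^ (2 * r + 1))⁻¹) = 1 := by
    generalize q ^ (2 * r + 1) = y at *
    have h5 : y + 1 ≠ 0 := by rwa [add_comm]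
    rw [show 1 + y⁻¹ = (1 + y) / y by field_simp; ring]
    field_simp
  linear_combination q ^ (3 * r ^ 2 + 3 * r) * K * h4

theorem tsum_zpow_zero (hq : ‖q‖ < 1) (hq0 : q ≠ 0) :
    ∑' r : ℤ, q ^ (3 * r ^ 2 + r) =
      qPochInf (-q ^ 4) (q ^ 6) * qPochInf (-q ^ 2) (q ^ 6) * qPochInf (q ^ 6) (q ^ 6) := by
  have h6 := norm_pow_lt_one hq (show 6 ≠ 0 by norm_num)
  have h := tsum_eq_tripleProduct (q := q ^ 6) (z := -q ^ 4) (w := fun r : ℤ => q ^ (3 * r ^ 2 + r))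
    h6 (pow_ne_zero _ hq0) (neg_ne_zero.2 (pow_ne_zero _ hq0)) (by simp) ?_
    (summable_norm_zpow hq fun r => ?_)
  · rw [h, show q ^ 6 / -q ^ 4 = -q ^ 2 by field_simp]
  · intro r
    rw [neg_neg, ← zpow_natCast, ← zpow_natCast, ← zpow_mul, ← zpow_add₀ hq0, ← zpow_add₀ hq0]
    congr 1
    push_cast
    ring
  · rw [abs_le]
    constructor
    · nlinarith [sq_nonneg r, sq_nonneg (r + 1)]
    · nlinarith [sq_nonneg r]

/-- The constant 1 is forced by r = -1, where 3r² + 3r = 0; `tsum_zpow_one` divides the extra power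
of q out again. -/
theorem abs_le_three_mul_sq_add (r : ℤ) : |r| ≤ 3 * r ^ 2 + 3 * r + 1 := by
  rw [abs_le]
  constructor <;> nlinarith [sq_nonneg r, sq_nonneg (r + 1)]

theorem tsum_zpow_one (hq : ‖q‖ < 1) (hq0 : q ≠ 0) :
    ∑' r : ℤ, q ^ (3 * r ^ 2 + 3 * r) =
      qPochInf (-q ^ 6) (q ^ 6) * qPochInf (-1) (q ^ 6) * qPochInf (q ^ 6) (q ^ 6) := by
  have h6 := norm_pow_lt_one hq (show 6 ≠ 0 by norm_num)
  have hs := (summable_norm_zpow hq abs_le_three_mul_sq_add).mul_right ‖q‖⁻¹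
  have h := tsum_eq_tripleProduct (q := q ^ 6) (z := -q ^ 6)
    (w := fun r : ℤ => q ^ (3 * r ^ 2 + 3 * r))
    h6 (pow_ne_zero _ hq0) (neg_ne_zero.2 (pow_ne_zero _ hq0)) (by simp) ?_ ?_
  · rw [h, show q ^ 6 / -q ^ 6 = -1 by field_simp]
  · intro r
    rw [neg_neg, ← zpow_natCast, ← zpow_mul, ← zpow_add₀ hq0, ← zpow_add₀ hq0]
    congr 1
    push_cast
    ring
  · refine hs.congr fun r => ?_
    rw [zpow_add_one₀ hq0, norm_mul, mul_inv_cancel_right₀ (norm_ne_zero_iff.2 hq0)]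

theorem tsum_slaterTerm_base_zero (m : ℕ) : ∑' n, slaterTerm 0 m n = 1 := by
  have h0 : ∀ n, qPoch 0 0 n = 1 := fun n => by simp [qPoch]
  rw [tsum_eq_single 0]
  · simp [slaterTerm, h0]
  · intro n hn
    simp [slaterTerm, hn]

theorem qPochInf_zero_left (q : ℂ) : qPochInf 0 q = 1 := by simp [qPochInf]

/-- The evaluation of `(-q; q²)_∞ (q; q)_∞ / (q²; q²)_∞`. -/
theorem qPochInf_conjugate_mul (hq : ‖q‖ < 1) :
    qPochInf (-q) (q ^ 2) * (qPochInf (q ^ 2) (q ^ 2))⁻¹ * qPochInf q q =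
      qPochInf (q ^ 2) (q ^ 4) := by
  have hp := norm_pow_lt_one hq two_ne_zero
  have h1 := qPochInf_sq q hq
  have h2 := qPochInf_mul_neg q hp
  rw [← sq] at h1
  rw [← pow_mul, show 2 * 2 = 4 by norm_num] at h2
  have h3 := qPochInf_self_ne_zero hp
  rw [← h1, ← h2]
  field_simp

/-- Dissect (-x;x)_∞ modulo 3 and apply Euler's identity at x and at x³: (x;x²)_∞ (-x;x³)_∞
(-x²;x³)_∞ = (x³;x⁶)_∞. -/
theorem triple_quotient_zero {x : ℂ} (hx : ‖x‖ < 1) :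
    qPochInf x (x ^ 2) *
        (qPochInf (-x ^ 2) (x ^ 3) * qPochInf (-x) (x ^ 3) * qPochInf (x ^ 3) (x ^ 3)) =
      qPochInf₃ (x ^ 3) (x ^ 3) (x ^ 6) (x ^ 6) := by
  have h3 := norm_pow_lt_one hx three_ne_zero
  have e1 := qPochInf_odd_mul_neg hx
  have e2 := qPochInf_odd_mul_neg h3
  have e3 := qPochInf_cube (-x) hx
  have e4 := qPochInf_sq (x ^ 3) h3
  rw [show -x * x = -x ^ 2 by ring, show -x * x ^ 2 = -x ^ 3 by ring] at e3
  rw [show x ^ 3 * x ^ 3 = x ^ 6 by ring] at e4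
  rw [← pow_mul] at e2 e4
  norm_num at e2 e4
  have hne : qPochInf (-x ^ 3) (x ^ 3) ≠ 0 := right_ne_zero_of_mul_eq_one e2
  rw [qPochInf₃, ← e4]
  apply mul_right_cancel₀ hne
  rw [← e3] at e1
  linear_combination (qPochInf (x ^ 3) (x ^ 6) * qPochInf (x ^ 6) (x ^ 6)) * (e1 - e2)

/-- Dissect (x;x²)_∞ modulo 3; its middle part (x³;x⁶)_∞ cancels one (-x³;x³)_∞ by Euler. The factor
2 is the first factor of (-1;x³)_∞. -/
theorem triple_quotient_one {x : ℂ} (hx : ‖x‖ < 1) :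
    qPochInf x (x ^ 2) *
        (qPochInf (-x ^ 3) (x ^ 3) * qPochInf (-1) (x ^ 3) * qPochInf (x ^ 3) (x ^ 3)) =
      2 * qPochInf₃ x (x ^ 5) (x ^ 6) (x ^ 6) := by
  have h2 := norm_pow_lt_one hx two_ne_zero
  have h3 := norm_pow_lt_one hx three_ne_zero
  have e1 := qPochInf_cube x h2
  have e2 := qPochInf_odd_mul_neg h3
  have e3 := qPochInf_mul_neg (x ^ 3) h3
  have e4 := qPochInf_eq_one_sub_mul (-1) h3
  rw [show (-1 : ℂ) * x ^ 3 = -x ^ 3 by ring] at e4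
  rw [show x * x ^ 2 = x ^ 3 by ring, show x * (x ^ 2) ^ 2 = x ^ 5 by ring] at e1
  simp only [← pow_mul] at e1 e2 e3
  norm_num at e1 e2 e3 e4
  rw [qPochInf₃, e4, ← e1, ← e3]
  linear_combination (2 * qPochInf x (x ^ 6) * qPochInf (x ^ 5) (x ^ 6) *
    qPochInf (x ^ 3) (x ^ 3) * qPochInf (-x ^ 3) (x ^ 3)) * e2

/-- Slater's product evaluation of the series for `m = 0`. -/
theorem slater_zero (hq : ‖q‖ < 1) :
    ∑' n, slaterTerm q 0 n = qPochInf₃ (q ^ 6) (q ^ 6) (q ^ 12) (q ^ 12) / qPochInf q q := by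
  -- The bilateral series need q ≠ 0; at q = 0 both sides equal 1.
  rcases eq_or_ne q 0 with rfl | hq0
  · simp [tsum_slaterTerm_base_zero, qPochInf₃, qPochInf_zero_left]
  have h := triple_quotient_zero (norm_pow_lt_one hq two_ne_zero)
  simp only [← pow_mul] at h
  norm_num at h
  rw [← h, ← qPochInf_conjugate_mul hq, ← tsum_zpow_zero hq hq0, tsum_slaterTerm_zero hq hq0]
  have := qPochInf_self_ne_zero hq
  field_simp

/-- Slater's product evaluation of the series for `m = 1`. -/
theorem slater_one (hq : ‖q‖ < 1) :
    ∑' n, slaterTerm q 1 n = qPochInf₃ (q ^ 2) (q ^ 10) (q ^ 12) (q ^ 12) / qPochInf q q := by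
  rcases eq_or_ne q 0 with rfl | hq0
  · simp [tsum_slaterTerm_base_zero, qPochInf₃, qPochInf_zero_left]
  have h := triple_quotient_one (norm_pow_lt_one hq two_ne_zero)
  simp only [← pow_mul] at h
  norm_num at h
  have h1 := tsum_slaterTerm_one hq hq0
  rw [tsum_zpow_one hq hq0] at h1
  rw [← qPochInf_conjugate_mul hq] at h
  have h2 := qPochInf_self_ne_zero hq
  rw [eq_div_iff h2]
  linear_combination (1 / 2) * qPochInf q q * h1 + (1 / 2) * h

end SlaterIdentities

/-! ### Gaussian binomials as power series coefficients -/

section ContiguousCoefficients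

/-- The `q`-binomial coefficient `(q; q)_{a+b} / ((q; q)_a (q; q)_b)`. -/
def qBinom (q : ℂ) (a b : ℕ) : ℂ := qPoch q q (a + b) / (qPoch q q a * qPoch q q b)

theorem gaussBinom_add (q : ℂ) (a b : ℕ) : gaussBinom q ((a : ℤ) + b) b = qBinom q a b := by
  rw [gaussBinom, if_pos (by omega), qBinom, add_sub_cancel_right, Int.toNat_natCast,
    Int.toNat_natCast, mul_comm, ← Nat.cast_add, Int.toNat_natCast]

variable {q : ℂ}

theorem qBinom_zero_right (hq : ‖q‖ < 1) (a : ℕ) : qBinom q a 0 = 1 := by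
  have := qPoch_ne_zero (one_sub_mul_pow_ne_zero hq hq) a
  rw [qBinom, qPoch_zero, add_zero, mul_one, div_self this]

theorem qBinom_zero_left (hq : ‖q‖ < 1) (b : ℕ) : qBinom q 0 b = 1 := by
  have := qPoch_ne_zero (one_sub_mul_pow_ne_zero hq hq) b
  rw [qBinom, qPoch_zero, zero_add, one_mul, div_self this]

theorem qBinom_succ_succ (hq : ‖q‖ < 1) (a b : ℕ) :
    qBinom q (a + 1) (b + 1) = qBinom q a (b + 1) + q ^ (a + 1) * qBinom q (a + 1) b := by
  have h := one_sub_mul_pow_ne_zero hq hq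
  have ha := qPoch_ne_zero h a
  have hb := qPoch_ne_zero h b
  have h1 := h a
  have h2 := h b
  simp only [qBinom]
  rw [show a + 1 + (b + 1) = a + b + 1 + 1 by ring, show a + (b + 1) = a + b + 1 by ring,
    show a + 1 + b = a + b + 1 by ring]
  simp only [qPoch_succ]
  field_simp
  ring

open PowerSeries

/-- The expansion of `1 / (t; q)_{k+1}`. -/
def qBinomSeries (q : ℂ) (k : ℕ) : ℂ⟦X⟧ := PowerSeries.mk fun i => qBinom q k i

/-- The expansion of `1 / (-t; q)_{k+1}`. -/
def altQBinomSeries (q : ℂ) (k : ℕ) : ℂ⟦X⟧ := PowerSeries.mk fun i => (-1) ^ i * qBinom q k i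

/-- The product `(-q t; q²)_k`. -/
def oddProductSeries (q : ℂ) (k : ℕ) : ℂ⟦X⟧ :=
  ∏ i ∈ Finset.range k, (1 + C (q ^ (2 * i + 1)) * X)

theorem qBinomSeries_zero (hq : ‖q‖ < 1) : qBinomSeries q 0 * (1 - X) = 1 := by
  ext n
  rw [mul_sub, mul_one, map_sub]
  rcases n with _ | n
  · simp [qBinomSeries, qBinom_zero_left hq]
  · simp [qBinomSeries, qBinom_zero_left hq, coeff_succ_mul_X, coeff_one]

/-- This is the q-Pascal rule read coefficientwise. -/
theorem qBinomSeries_succ (hq : ‖q‖ < 1) (k : ℕ) :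
    qBinomSeries q (k + 1) * (1 - C (q ^ (k + 1)) * X) = qBinomSeries q k := by
  ext n
  rw [mul_sub, mul_one, map_sub, mul_left_comm]
  rcases n with _ | n
  · simp [qBinomSeries, qBinom_zero_right hq]
  · rw [coeff_C_mul, coeff_succ_mul_X]
    simp only [qBinomSeries, coeff_mk, qBinom_succ_succ hq]
    ring

theorem altQBinomSeries_zero (hq : ‖q‖ < 1) : altQBinomSeries q 0 * (1 + X) = 1 := by
  ext n
  rw [mul_add, mul_one, map_add]
  rcases n with _ | n
  · simp [altQBinomSeries, qBinom_zero_left hq]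
  · simp [altQBinomSeries, qBinom_zero_left hq, coeff_succ_mul_X, coeff_one, pow_succ]

theorem altQBinomSeries_succ (hq : ‖q‖ < 1) (k : ℕ) :
    altQBinomSeries q (k + 1) * (1 + C (q ^ (k + 1)) * X) = altQBinomSeries q k := by
  ext n
  rw [mul_add, mul_one, map_add, mul_left_comm]
  rcases n with _ | n
  · simp [altQBinomSeries, qBinom_zero_right hq]
  · rw [coeff_C_mul, coeff_succ_mul_X]
    simp only [altQBinomSeries, coeff_mk, qBinom_succ_succ hq]
    ring

theorem gaussBinom_succ_succ (hq : ‖q‖ < 1) (k l : ℕ) :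
    gaussBinom q ((k + 1 : ℕ) : ℤ) ((l + 1 : ℕ) : ℤ) =
      gaussBinom q k ((l + 1 : ℕ) : ℤ) + q ^ (k - l) * gaussBinom q k l := by
  rcases lt_trichotomy k l with h | rfl | h
  · simp only [gaussBinom]
    rw [if_neg (by omega), if_neg (by omega), if_neg (by omega)]
    simp
  · have h1 := gaussBinom_add q 0 (k + 1)
    have h2 := gaussBinom_add q 0 k
    simp only [Nat.cast_zero, zero_add, qBinom_zero_left hq] at h1 h2
    rw [h1, h2, gaussBinom, if_neg (by omega)]
    simp
  · obtain ⟨d, rfl⟩ : ∃ d, k = d + 1 + l := ⟨k - l - 1, by omega⟩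
    have h1 := gaussBinom_add q (d + 1) (l + 1)
    have h2 := gaussBinom_add q d (l + 1)
    have h3 := gaussBinom_add q (d + 1) l
    rw [← Nat.cast_add] at h1 h2 h3
    rw [show d + 1 + l + 1 = d + 1 + (l + 1) by ring, h1, h3,
      show d + 1 + l = d + (l + 1) by ring, h2, show d + (l + 1) - l = d + 1 by omega,
      qBinom_succ_succ hq]

/-- The finite q-binomial theorem, by induction on k through the q-Pascal rule. -/
theorem coeff_oddProductSeries (hq : ‖q‖ < 1) (k l : ℕ) :
    coeff l (oddProductSeries q k) = q ^ l ^ 2 * gaussBinom (q ^ 2) k l := by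
  have hp := norm_pow_lt_one hq two_ne_zero
  induction k generalizing l with
  | zero =>
    rcases l with _ | l
    · simp [oddProductSeries, gaussBinom, qPoch]
    · rw [gaussBinom, if_neg (by omega)]
      simp [oddProductSeries, coeff_one]
  | succ k ih =>
    rw [oddProductSeries, Finset.prod_range_succ, ← oddProductSeries, mul_add, mul_one, map_add,
      mul_left_comm]
    rcases l with _ | l
    · have h1 := gaussBinom_add (q ^ 2) (k + 1) 0
      have h2 := gaussBinom_add (q ^ 2) k 0
      simp only [Nat.cast_zero, add_zero, qBinom_zero_right hp] at h1 h2
      rw [ih, Nat.cast_zero, h1, h2]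
      simp
    · rw [coeff_C_mul, coeff_succ_mul_X, ih, ih, gaussBinom_succ_succ hp]
      by_cases h : l ≤ k
      · obtain ⟨d, rfl⟩ := Nat.exists_eq_add_of_le h
        rw [Nat.add_sub_cancel_left]
        ring
      · rw [show gaussBinom (q ^ 2) (k : ℤ) (l : ℤ) = 0 by rw [gaussBinom, if_neg (by omega)]]
        ring

/-! ### The kernel series and its recurrence -/

/-- The expansion of `(-q t; q²)_k / (t²; q⁴)_{k+1}`. -/
def kernelSeries (q : ℂ) (k : ℕ) : ℂ⟦X⟧ :=
  altQBinomSeries (q ^ 2) k * (oddProductSeries q k * qBinomSeries (q ^ 2) k)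

theorem kernelSeries_zero (hq : ‖q‖ < 1) : kernelSeries q 0 = 1 + kernelSeries q 0 * X ^ 2 := by
  have hp := norm_pow_lt_one hq two_ne_zero
  have h1 := qBinomSeries_zero hp
  have h2 := altQBinomSeries_zero hp
  have h3 : kernelSeries q 0 = altQBinomSeries (q ^ 2) 0 * qBinomSeries (q ^ 2) 0 := by
    simp [kernelSeries, oddProductSeries]
  rw [h3]
  linear_combination altQBinomSeries (q ^ 2) 0 * (1 + X) * h1 + h2

/-- Equivalent to (1 - q^{4(k+1)} t²) K_{k+1} = (1 + q^{2k+1} t) K_k, arranged so that coefficients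
can be compared. -/
theorem kernelSeries_succ (hq : ‖q‖ < 1) (k : ℕ) :
    kernelSeries q (k + 1) = kernelSeries q k + C (q ^ (2 * k + 1)) * (kernelSeries q k * X) +
      C (q ^ (4 * (k + 1))) * (kernelSeries q (k + 1) * X ^ 2) := by
  have hp := norm_pow_lt_one hq two_ne_zero
  have h1 := qBinomSeries_succ hp k
  have h2 := altQBinomSeries_succ hp k
  have h3 : oddProductSeries q (k + 1) =
      oddProductSeries q k * (1 + C (q ^ (2 * k + 1)) * X) := by
    rw [oddProductSeries, Finset.prod_range_succ, ← oddProductSeries]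
  have h4 : (C (q ^ (4 * (k + 1))) : ℂ⟦X⟧) = C ((q ^ 2) ^ (k + 1)) * C ((q ^ 2) ^ (k + 1)) := by
    rw [← map_mul]
    congr 1
    ring
  simp only [kernelSeries]
  rw [h3, h4, ← h1, ← h2]
  ring

/-- The common form `∑ q^{n² + e n} [tⁿ] (-q t; q²)_k / (t²; q⁴)_{k+1}`, `k + n = M`, of the
coefficients `a` and `b`. -/
def kernelSum (q : ℂ) (e M : ℕ) : ℂ :=
  ∑ x ∈ Finset.HasAntidiagonal.antidiagonal M, q ^ (x.2 ^ 2 + e * x.2) * coeff x.2 (kernelSeries q x.1)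

theorem kernelSum_zero (hq : ‖q‖ < 1) (e : ℕ) : kernelSum q e 0 = 1 := by
  simp only [kernelSum, Finset.Nat.antidiagonal_zero, Finset.sum_singleton]
  rw [kernelSeries_zero hq]
  simp

theorem kernelSum_one (hq : ‖q‖ < 1) (e : ℕ) : kernelSum q e 1 = 1 := by
  have h0 : coeff 0 (kernelSeries q 0) = 1 := by
    rw [kernelSeries_zero hq]
    simp
  have h1 : coeff 1 (kernelSeries q 0) = 0 := by
    rw [kernelSeries_zero hq, map_add, coeff_mul_X_pow', if_neg (by norm_num)]
    simp [coeff_one]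
  have h2 : coeff 0 (kernelSeries q 1) = 1 := by
    rw [kernelSeries_succ hq]
    simpa using h0
  rw [kernelSum, Finset.Nat.sum_antidiagonal_succ]
  simp [h1, h2]

/-- The three terms of the kernel recurrence lower (k, n) by (1, 0), (1, 1) and (0, 2). In the last
two, completing the square makes the extra power of q depend only on k + n = M: it is q^{e+2(M+1)}
and its square. -/
theorem kernelSum_add_two (hq : ‖q‖ < 1) (e M : ℕ) :
    kernelSum q e (M + 2) = kernelSum q e (M + 1) +
      q ^ (e + 2 * (M + 1)) * (1 + q ^ (e + 2 * (M + 1))) * kernelSum q e M := by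
  have hsplit : kernelSum q e (M + 2) = kernelSum q e (M + 1) +
      ∑ x ∈ Finset.HasAntidiagonal.antidiagonal (M + 1), q ^ (x.2 ^ 2 + e * x.2) * (q ^ (2 * x.1 + 1) *
        coeff x.2 (kernelSeries q x.1 * X)) +
      ∑ x ∈ Finset.HasAntidiagonal.antidiagonal (M + 2), q ^ (x.2 ^ 2 + e * x.2) * (q ^ (4 * x.1) *
        coeff x.2 (kernelSeries q x.1 * X ^ 2)) := by
    rw [kernelSum, Finset.Nat.sum_antidiagonal_succ, Finset.Nat.sum_antidiagonal_succ (n := M + 1),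
      kernelSum]
    -- At k = 0 the kernel is 1/(1 - t²), whose recurrence has a constant term 1 that does not reach
    -- degree M + 2.
    have h0 : coeff (M + 2) (kernelSeries q 0) = coeff (M + 2) (kernelSeries q 0 * X ^ 2) := by
      conv_lhs => rw [kernelSeries_zero hq]
      simp [coeff_one]
    have h1 : ∀ x : ℕ × ℕ, q ^ (x.2 ^ 2 + e * x.2) * coeff x.2 (kernelSeries q (x.1 + 1)) =
        q ^ (x.2 ^ 2 + e * x.2) * coeff x.2 (kernelSeries q x.1) +
        q ^ (x.2 ^ 2 + e * x.2) * (q ^ (2 * x.1 + 1) * coeff x.2 (kernelSeries q x.1 * X)) +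
        q ^ (x.2 ^ 2 + e * x.2) *
          (q ^ (4 * (x.1 + 1)) * coeff x.2 (kernelSeries q (x.1 + 1) * X ^ 2)) := by
      intro x
      conv_lhs => rw [kernelSeries_succ hq]
      rw [map_add, map_add, coeff_C_mul, coeff_C_mul]
      ring
    simp only [h0, h1, Finset.sum_add_distrib]
    ring
  have hone : ∑ x ∈ Finset.HasAntidiagonal.antidiagonal (M + 1), q ^ (x.2 ^ 2 + e * x.2) * (q ^ (2 * x.1 + 1) *
        coeff x.2 (kernelSeries q x.1 * X)) = q ^ (e + 2 * (M + 1)) * kernelSum q e M := by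
    rw [Finset.Nat.sum_antidiagonal_succ', kernelSum, Finset.mul_sum]
    simp only [coeff_succ_mul_X, coeff_zero_mul_X, mul_zero, zero_add]
    refine Finset.sum_congr rfl fun x hx => ?_
    rw [← Finset.HasAntidiagonal.mem_antidiagonal.1 hx]
    ring
  have htwo : ∑ x ∈ Finset.HasAntidiagonal.antidiagonal (M + 2), q ^ (x.2 ^ 2 + e * x.2) * (q ^ (4 * x.1) *
        coeff x.2 (kernelSeries q x.1 * X ^ 2)) =
      q ^ (e + 2 * (M + 1)) * q ^ (e + 2 * (M + 1)) * kernelSum q e M := by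
    rw [Finset.Nat.sum_antidiagonal_succ', Finset.Nat.sum_antidiagonal_succ', kernelSum,
      Finset.mul_sum]
    simp only [pow_two X, ← mul_assoc, coeff_succ_mul_X, coeff_zero_mul_X, mul_zero, zero_add]
    refine Finset.sum_congr rfl fun x hx => ?_
    rw [← Finset.HasAntidiagonal.mem_antidiagonal.1 hx]
    ring
  rw [hsplit, hone, htwo]
  ring

/-! ### Matching the triple sums with the kernel -/

/-- The common form of the summands of `a` and `b`. -/
def tripleTerm (q : ℂ) (e M : ℕ) (p : ℕ × ℕ × ℕ) : ℂ :=
  (-1) ^ p.2.1 * q ^ (p.1 ^ 2 + e * p.1 + p.2.2 ^ 2)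
    * gaussBinom (q ^ 2) ((M : ℤ) - p.1 + p.2.1) p.2.1
    * gaussBinom (q ^ 2) ((M : ℤ) - p.2.1 - p.2.2) ((p.1 : ℤ) - p.2.1 - p.2.2)
    * gaussBinom (q ^ 2) ((M : ℤ) - p.1) p.2.2

/-- With k = M - n, the three Gaussian binomials are, up to signs and powers of q, the coefficients
of t^j, t^{n-j-l} and t^l in 1/(-t;q²)_{k+1}, 1/(t;q²)_{k+1} and (-qt;q²)_k. -/
theorem tripleTerm_eq (hq : ‖q‖ < 1) (e : ℕ) {M n j l : ℕ} (hn : n ≤ M) (hjl : j + l ≤ n) :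
    tripleTerm q e M (n, j, l) = q ^ (n ^ 2 + e * n) *
      (coeff j (altQBinomSeries (q ^ 2) (M - n)) *
        (coeff l (oddProductSeries q (M - n)) *
          coeff (n - j - l) (qBinomSeries (q ^ 2) (M - n)))) := by
  obtain ⟨k, rfl⟩ := Nat.exists_eq_add_of_le hn
  obtain ⟨i, rfl⟩ := Nat.exists_eq_add_of_le hjl
  rw [coeff_oddProductSeries hq]
  simp only [tripleTerm, altQBinomSeries, qBinomSeries, coeff_mk]
  rw [show j + l + i + k - (j + l + i) = k by omega, show j + l + i - j - l = i by omega,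
    ← gaussBinom_add, ← gaussBinom_add]
  push_cast
  rw [show (j : ℤ) + l + i + k - (j + l + i) = k by ring,
    show (j : ℤ) + l + i + k - j - l = k + i by ring, show (j : ℤ) + l + i - j - l = i by ring]
  ring

theorem tripleTerm_eq_zero (e : ℕ) {M n j l : ℕ} (h : ¬(n ≤ M ∧ j + l ≤ n)) :
    tripleTerm q e M (n, j, l) = 0 := by
  have h1 : gaussBinom (q ^ 2) ((M : ℤ) - j - l) ((n : ℤ) - j - l) = 0 := by
    rw [gaussBinom, if_neg (by omega)]
  simp only [tripleTerm, h1, mul_zero, zero_mul]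

theorem tsum_tripleTerm (hq : ‖q‖ < 1) (e M : ℕ) :
    ∑' p, tripleTerm q e M p = kernelSum q e M := by
  rw [tsum_eq_sum (s := Finset.range (M + 1) ×ˢ Finset.range (M + 1) ×ˢ Finset.range (M + 1)),
    Finset.sum_product, kernelSum, ← Finset.Nat.sum_antidiagonal_swap,
    Finset.Nat.sum_antidiagonal_eq_sum_range_succ_mk]
  · refine Finset.sum_congr rfl fun n hn => ?_
    have hn' : n ≤ M := by simpa [Nat.lt_succ_iff] using hn
    simp only [Prod.fst_swap, Prod.snd_swap]
    rw [kernelSeries, coeff_mul, Finset.Nat.sum_antidiagonal_eq_sum_range_succ_mk,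
      Finset.mul_sum, Finset.sum_product]
    refine (Finset.sum_subset (s₁ := Finset.range n.succ)
      (Finset.range_subset_range.2 (by omega)) ?_).symm.trans ?_
    · intro j _ hj
      rw [Finset.mem_range] at hj
      exact Finset.sum_eq_zero fun l _ => tripleTerm_eq_zero e (by omega)
    · refine Finset.sum_congr rfl fun j hj => ?_
      rw [Finset.mem_range] at hj
      simp only []
      rw [coeff_mul, Finset.Nat.sum_antidiagonal_eq_sum_range_succ_mk, Finset.mul_sum,
        Finset.mul_sum]
      refine (Finset.sum_subset (s₁ := Finset.range (n - j).succ)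
        (Finset.range_subset_range.2 (by omega)) ?_).symm.trans ?_
      · intro l _ hl
        rw [Finset.mem_range] at hl
        exact tripleTerm_eq_zero e (by omega)
      · refine Finset.sum_congr rfl fun l hl => ?_
        rw [Finset.mem_range] at hl
        exact tripleTerm_eq hq e hn' (by omega)
  · rintro ⟨n, j, l⟩ h
    simp only [Finset.mem_product, Finset.mem_range] at h
    exact tripleTerm_eq_zero e (by omega)

theorem aCoeff_succ (hq : ‖q‖ < 1) (M : ℕ) : aCoeff q (M + 1) = kernelSum q 0 M := by
  rw [aCoeff, if_neg (Nat.succ_ne_zero M), ← tsum_tripleTerm hq]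
  refine tsum_congr fun p => ?_
  simp only [aTerm, tripleTerm, Nat.cast_add, Nat.cast_one, add_sub_cancel_right, zero_mul,
    add_zero]

theorem bCoeff_add_two (hq : ‖q‖ < 1) (M : ℕ) : bCoeff q (M + 2) = kernelSum q 2 M := by
  rw [bCoeff, if_neg (by omega), ← tsum_tripleTerm hq]
  refine tsum_congr fun p => ?_
  simp only [bTerm, tripleTerm, Nat.cast_add, Nat.cast_ofNat, add_sub_cancel_right]

theorem bCoeff_one : bCoeff q 1 = 0 := by
  rw [bCoeff, if_neg one_ne_zero]
  refine (tsum_congr fun p => ?_).trans tsum_zero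
  obtain ⟨n, j, l⟩ := p
  -- The integer top j - 1 - n is smaller than j, so every summand vanishes.
  have h : gaussBinom (q ^ 2) (((1 : ℕ) : ℤ) - 2 - n + j) j = 0 := by
    rw [gaussBinom, if_neg (by omega)]
  simp only [bTerm, h, mul_zero, zero_mul]

theorem aCoeff_rec (hq : ‖q‖ < 1) (m : ℕ) : aCoeff q (m + 3) =
    aCoeff q (m + 2) + (q ^ 2) ^ (m + 1) * (1 + (q ^ 2) ^ (m + 1)) * aCoeff q (m + 1) := by
  rw [aCoeff_succ hq, aCoeff_succ hq, aCoeff_succ hq, kernelSum_add_two hq, ← pow_mul, zero_add]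

/-- The choice e = 2 compensates for M = m - 2 in place of m - 1, so b obeys the same recurrence as
a. The first case uses b_1 = 0 and b_2 = b_3 = 1. -/
theorem bCoeff_rec (hq : ‖q‖ < 1) (m : ℕ) : bCoeff q (m + 3) =
    bCoeff q (m + 2) + (q ^ 2) ^ (m + 1) * (1 + (q ^ 2) ^ (m + 1)) * bCoeff q (m + 1) := by
  rcases m with _ | m
  · rw [bCoeff_one, bCoeff_add_two hq, bCoeff_add_two hq, kernelSum_one hq, kernelSum_zero hq]
    ring
  · rw [bCoeff_add_two hq, bCoeff_add_two hq, bCoeff_add_two hq, kernelSum_add_two hq, ← pow_mul,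
      show 2 + 2 * (m + 1) = 2 * (m + 1 + 1) by ring]

/-- The identity with denominators cleared, for `m + 1`. -/
theorem slaterTerm_closed_form (hq : ‖q‖ < 1) (m : ℕ) :
    (∑' n, slaterTerm q (m + 1) n) * (q ^ ((m + 1) * m) * qPoch (-(q ^ 2)) (q ^ 2) m) *
        qPochInf q q =
      (-1) ^ m * (aCoeff q (m + 1) * qPochInf₃ (q ^ 2) (q ^ 10) (q ^ 12) (q ^ 12) -
        bCoeff q (m + 1) * qPochInf₃ (q ^ 6) (q ^ 6) (q ^ 12) (q ^ 12)) := by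
  have hP := qPochInf_self_ne_zero hq
  have h0 := (eq_div_iff hP).1 (slater_zero hq)
  have h1 := (eq_div_iff hP).1 (slater_one hq)
  induction m using Nat.twoStepInduction with
  | zero =>
    rw [zero_add, bCoeff_one, ← zero_add 1, aCoeff_succ hq, kernelSum_zero hq, zero_add, ← h1]
    simp [qPoch_zero]
  -- S_2 comes from S_0 and S_1 by the contiguous relation, and a_2 = b_2 = 1. The recurrence for a
  -- and b starts only at index 1, hence this separate case.
  | one =>
    have h := tsum_slaterTerm_sub hq 0
    rw [show 1 + 1 = 0 + 2 by rfl, bCoeff_add_two hq, aCoeff_succ hq, kernelSum_zero hq,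
      kernelSum_one hq, ← h0, ← h1, qPoch_succ, qPoch_zero]
    linear_combination (-qPochInf q q) * h
  | more m ih1 ih2 =>
    have h := tsum_slaterTerm_sub hq (m + 1)
    have e1 : qPoch (-(q ^ 2)) (q ^ 2) (m + 1) =
      qPoch (-(q ^ 2)) (q ^ 2) m * (1 + (q ^ 2) ^ (m + 1)) := by rw [qPoch_succ]; ring
    have e2 : qPoch (-(q ^ 2)) (q ^ 2) (m + 2) =
      qPoch (-(q ^ 2)) (q ^ 2) (m + 1) * (1 + (q ^ 2) ^ (m + 2)) := by rw [qPoch_succ]; ring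
    rw [show m + 2 + 1 = m + 3 from rfl, aCoeff_rec hq, bCoeff_rec hq, e2]
    rw [show m + 1 + 1 = m + 2 from rfl] at ih2 h
    rw [show m + 1 + 2 = m + 3 from rfl] at h
    linear_combination (q ^ 2) ^ (m + 1) * (1 + (q ^ 2) ^ (m + 1)) * ih1 - ih2 -
      q ^ ((m + 2) * (m + 1)) * qPoch (-(q ^ 2)) (q ^ 2) (m + 1) * qPochInf q q * h +
      (∑' n, slaterTerm q (m + 1) n) * q ^ ((m + 2) * (m + 1)) * qPochInf q q * e1

end ContiguousCoefficients

end

end SlaterMVersion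

theorem corollary3p5 (q : ℂ) (hq : ‖q‖ < 1) (m : ℕ) (hq0 : 2 ≤ m → q ≠ 0) :
    HasSum
      (fun n : ℕ =>
        SlaterMVersion.qPoch (-q) (q ^ 2) n * q ^ (n ^ 2 + 2 * m * n) /
          (SlaterMVersion.qPoch q (q ^ 2) (m + n) * SlaterMVersion.qPoch (q ^ 2) (q ^ 2) n))
      ((-1 : ℂ) ^ ((m : ℤ) - 1) /
          (q ^ (m * (m - 1)) * SlaterMVersion.qPoch (-(q ^ 2)) (q ^ 2) (m - 1) *
            SlaterMVersion.qPochInf q q) *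
        (SlaterMVersion.aCoeff q m *
            SlaterMVersion.qPochInf₃ (q ^ 2) (q ^ 10) (q ^ 12) (q ^ 12) -
          SlaterMVersion.bCoeff q m *
            SlaterMVersion.qPochInf₃ (q ^ 6) (q ^ 6) (q ^ 12) (q ^ 12))) := by
  have hP := SlaterMVersion.qPochInf_self_ne_zero hq
  have hsum := (SlaterMVersion.summable_slaterTerm hq m).hasSum
  refine (congrArg (HasSum (SlaterMVersion.slaterTerm q m)) ?_).mp hsum
  rcases m with _ | m
  -- For m = 0 the truncated m - 1 is 0, giving the empty product, while the integer exponent gives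
  -- (-1)^{-1} = -1, cancelling the sign of b_0.
  · rw [SlaterMVersion.slater_zero hq]
    simp [SlaterMVersion.aCoeff, SlaterMVersion.bCoeff, SlaterMVersion.qPoch_zero]
    ring
  · have hp := SlaterMVersion.norm_pow_lt_one hq two_ne_zero
    have hB : SlaterMVersion.qPoch (-(q ^ 2)) (q ^ 2) m ≠ 0 :=
      SlaterMVersion.qPoch_ne_zero
        (SlaterMVersion.one_sub_mul_pow_ne_zero (by rwa [norm_neg]) hp) m
    -- When the original index is 1 the exponent is 0, so q = 0 is harmless; from index 2 on q ≠ 0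
    -- is assumed.
    have hA : q ^ ((m + 1) * m) ≠ 0 := by
      rcases m with _ | m
      · simp
      · exact pow_ne_zero _ (hq0 (by omega))
    have h := SlaterMVersion.slaterTerm_closed_form hq m
    rw [Nat.add_sub_cancel, Nat.cast_add, Nat.cast_one, add_sub_cancel_right, zpow_natCast,
      div_mul_eq_mul_div, eq_div_iff (mul_ne_zero (mul_ne_zero hA hB) hP), ← h]
    ring
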